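/- **Setting.** Let $\mathcal D'$ be the space of complex-valued Schwartz distributions on $\mathbb R$, write $\psi^{(i)}$ for distributional derivatives, let $H$ be the Heaviside function ($H(x)=1$ for $x\ge 0$, $H(x)=0$ for $x<0$) and $H_-=1-H$. A function $g:\mathbb R\to\mathbb C$ is *piecewise smooth* if it is $\mathcal C^\infty$ off a finite set $I$ and all its derivatives have finite lateral limits at the points of $I$. Let $\mathcal A\subset\mathcal D'$ be the space of all distributional derivatives, of all orders $\ge 0$, of piecewise smooth functions; for $\Omega$ open, $\mathcal A(\Omega)=\{F|_\Omega: F\in\mathcal A\}$. For $F,G\in\mathcal A$ put $$F*G=\lim_{\epsilon\downarrow 0}F(x)\cdot G(x+\epsilon)\quad\text{in }\mathcal D',$$ where $\cdot$ is the Hörmander product of distributions with disjoint singular supports (on every open set where one factor is a smooth function it is the usual product of the other factor by that function). The *order* $\operatorname{ord}F$ is the least $k\ge 0$ such that $F$ is the $k$-th distributional derivative of a locally integrable function. Let $n\in\mathbb N_0$, $f\in\mathcal C^\infty(\mathbb R)$ and $$a_i=H_-a_{i-}+Ha_{i+}+A_i,\qquad b_i=H_-b_{i-}+Hb_{i+}+B_i\qquad(i=0,\dots,n),$$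 with $a_{i\pm},b_{i\pm}\in\mathcal C^\infty(\mathbb R)$ complex-valued and $A_i,B_i$ finite linear combinations, with complex coefficients, of $\delta$ and its derivatives at $0$. Put $M=\max\{\operatorname{ord}A_i,\operatorname{ord}B_i: i=0,\dots,n\}$. Consider the equation $$\sum_{i=0}^n\bigl(a_i*\psi^{(i)}+\psi^{(i)}*b_i\bigr)=f,\tag{E}$$ whose solutions are the $\psi\in\mathcal A$ that satisfy it in the sense of distributions. A *regular interval* of (E) is an open interval $\Omega$ that does not meet the singular supports of the $a_i,b_i$; let $a_{i\overline\Omega},b_{i\overline\Omega}\in\mathcal C^\infty(\overline\Omega)$ be the smooth extensions to $\overline\Omega$ of $a_i|_\Omega,b_i|_\Omega$. Equation (E) is *sectionally regular* if for every regular interval $\Omega$, every $x_0\in\overline\Omega$ and every $C\in\mathbb C^n$ the initial value problem $$\sum_{i=0}^n(a_{i\overline\Omega}+b_{i\overline\Omega})\,u^{(i)}=f,\qquad u^{(j)}(x_0)=C_{j+1}\quad(0\le j\le n-1)$$ has a unique solution, and this solution belongs to $\mathcal C^\infty(\overline\Omega)$. Here solutions are understood in the distributional sense: uniqueness is among all $u\in\mathcal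 A(\Omega)$ that satisfy the equation on $\Omega$ in the sense of distributions and coincide near $x_0$ with a function that is smooth up to the boundary of $\Omega$ and has the prescribed derivatives at $x_0$ (one-sided ones if $x_0$ is an end point of $\Omega$). **Theorem.** Suppose that (E) is sectionally regular and $a_{n-}(0)+b_{n+}(0)\neq 0$. Then every solution $\psi$ of (E) has the form $$\psi=H_-\psi_-+H\psi_++\Delta,$$ where $\Delta\in\mathcal D'$ and $\psi_-,\psi_+\in\mathcal C^\infty(\mathbb R)$ satisfy $$\sum_{i=0}^n(a_{i-}+b_{i-})\psi_-^{(i)}=f\ \text{ on }(-\infty,0],\qquad \sum_{i=0}^n(a_{i+}+b_{i+})\psi_+^{(i)}=f\ \text{ on }[0,\infty).$$ Moreover, (i) if $M\le n$, then $\Delta=0$; (ii) if $M>n$, then $\operatorname{supp}\Delta\subseteq\{0\}$ and $\operatorname{ord}\Delta\le M-n$. -/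

import Mathlib

open scoped ContDiff Topology Distributions
open MeasureTheory Filter TopologicalSpace

namespace SingularODE

noncomputable section

/-! ### Distributions on the real line -/

/-- Complex-valued test functions on `ℝ`: smooth functions with compact support. -/
abbrev TestFn := TestFunction (⊤ : Opens ℝ) ℂ ⊤

/-- Schwartz distributions on `ℝ`: continuous linear functionals on the space of test functions
(with its LF topology). A restriction `F|_Ω` to an open set `Ω` is expressed by testing `F` only
against test functions whose support is contained in `Ω`. -/
abbrev Distr := TestFn →L[ℂ] ℂ

/-- The regular distribution `t ↦ ∫ t g` of a locally integrable function `g`. -/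
def reg (g : ℝ → ℂ) : Distr :=
  TestFunction.integralAgainstBilinCLM (ContinuousLinearMap.mul ℂ ℂ) volume g

/-- The distributional derivative, `⟨F', t⟩ = -⟨F, t'⟩`. -/
def D (F : Distr) : Distr :=
  -(F.comp (TestFunction.lineDerivCLM ℂ (1 : ℝ) : TestFn →L[ℂ] TestFn))

/-- The Dirac measure at the origin. -/
def delta : Distr where
  toFun t := t 0
  map_add' _ _ := rfl
  map_smul' _ _ := rfl
  cont := continuous_eval_const _

/-- `∑ₖ cₖ δ⁽ᵏ⁾`, for finitely many coefficients `cₖ`. -/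
def deltaComb (c : ℕ →₀ ℂ) : Distr := c.sum fun k z => z • D^[k] delta

theorem iteratedFDeriv_shift_eq (ε : ℝ) (f : ℝ → ℂ) (i : ℕ) (x : ℝ) :
    iteratedFDeriv ℝ i (fun y => f (y - ε)) x = iteratedFDeriv ℝ i f (x - ε) :=
  iteratedFDeriv_comp_sub i ε x

/-- Translation of test functions, `t ↦ t(· - ε)`, as a continuous linear map. -/
def shiftTest (ε : ℝ) : TestFn →L[ℂ] TestFn :=
  TestFunction.limitCLM ℂ
    (fun t => ⟨fun x => t (x - ε), t.contDiff.comp (contDiff_id.sub contDiff_const),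
      t.hasCompactSupport.comp_homeomorph (Homeomorph.subRight ε),
      fun _ _ => trivial⟩)
    (fun K _ =>
      (TestFunction.ofSupportedInCLM ℂ
        (K := ⟨(fun x => x + ε) '' K, K.isCompact.image (by fun_prop)⟩)
        (Ω := (⊤ : Opens ℝ)) (fun _ _ => trivial)) ∘L
      ContDiffMapSupportedIn.mkCLM ℂ (fun t x => t (x - ε))
        (fun _ _ _ => rfl) (fun _ _ _ => rfl)
        (fun t => t.contDiff.comp (contDiff_id.sub contDiff_const))
        (fun t x hx => t.zero_on_compl fun h => hx ⟨x - ε, h, by simp⟩)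
        (fun i hi => ⟨{i}, 1, zero_le_one, fun t x _ => by
          rw [iteratedFDeriv_shift_eq ε t i x, one_mul, Finset.sup_singleton]
          exact ContDiffMapSupportedIn.norm_iteratedFDeriv_apply_le_seminorm ℂ hi⟩))
    (fun _ _ _ => rfl)

/-- The translate `G(x + ε)` of a distribution `G(x)`:
`⟨G(x + ε), t(x)⟩ = ⟨G(x), t(x - ε)⟩`. -/
def translate (ε : ℝ) (G : Distr) : Distr := G.comp (shiftTest ε)

/-- The product `g t` of a test function `t` supported in the open set `Ξ` by a function `g` that
is smooth on `Ξ`. -/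
def mulTest {Ξ : Set ℝ} (hΞ : IsOpen Ξ) {g : ℝ → ℂ} (hg : ContDiffOn ℝ ∞ g Ξ) (t : TestFn)
    (ht : tsupport t ⊆ Ξ) : TestFn where
  toFun x := g x * t x
  contDiff' := by
    rw [contDiff_iff_contDiffAt]
    intro x
    by_cases hx : x ∈ tsupport t
    · exact (hg.contDiffAt (hΞ.mem_nhds (ht hx))).mul t.contDiff.contDiffAt
    · have h0 : (fun y => g y * t y) =ᶠ[𝓝 x] fun _ => 0 := by
        filter_upwards [notMem_tsupport_iff_eventuallyEq.mp hx] with y hy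
        simp [hy]
      exact contDiffAt_const.congr_of_eventuallyEq h0
  hasCompactSupport' := t.hasCompactSupport.mul_left
  tsupport_subset' := fun _ _ => trivial

/-- On the open set `Ξ`, the distribution `F` is the regular distribution of `g`. -/
def EqFunOn (F : Distr) (g : ℝ → ℂ) (Ξ : Set ℝ) : Prop :=
  ∀ t : TestFn, tsupport t ⊆ Ξ → F t = ∫ x, g x * t x

/-- On the open set `Ξ`, the distribution `F` is the smooth function `g`. -/
def IsSmoothOn (F : Distr) (g : ℝ → ℂ) (Ξ : Set ℝ) : Prop :=
  ContDiffOn ℝ ∞ g Ξ ∧ EqFunOn F g Ξ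

/-- The singular support: the set of points without an open neighbourhood on which the
distribution is a smooth function. -/
def singSupp (F : Distr) : Set ℝ :=
  {x | ¬ ∃ Ξ : Set ℝ, IsOpen Ξ ∧ x ∈ Ξ ∧ ∃ g : ℝ → ℂ, IsSmoothOn F g Ξ}

/-- The order of a distribution: the least `k` such that the distribution is the `k`-th
derivative of a regular distribution (and `⊤` if there is no such `k`). -/
def ord (F : Distr) : ℕ∞ :=
  sInf ((fun k : ℕ => (k : ℕ∞)) ''
    {k : ℕ | ∃ g : ℝ → ℂ, LocallyIntegrable g volume ∧ F = D^[k] (reg g)})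

/-! ### The space `𝒜` -/

/-- Piecewise smooth functions: smooth off a finite set `I`, with finite lateral limits of all
derivatives at the points of `I`. -/
def PiecewiseSmooth (f : ℝ → ℂ) : Prop :=
  ∃ I : Set ℝ, I.Finite ∧ ContDiffOn ℝ ∞ f Iᶜ ∧
    ∀ x ∈ I, ∀ j : ℕ,
      (∃ l : ℂ, Tendsto (iteratedDeriv j f) (𝓝[<] x) (𝓝 l)) ∧
      (∃ l : ℂ, Tendsto (iteratedDeriv j f) (𝓝[>] x) (𝓝 l))

/-- The space `𝒜` of all distributional derivatives, of all orders `k ≥ 0`, of piecewise smooth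
functions. -/
def spaceA : Set Distr := {F | ∃ (k : ℕ) (f : ℝ → ℂ), PiecewiseSmooth f ∧ F = D^[k] (reg f)}

/-! ### The product `*` -/

/-- On the open set `Ξ`, the distribution `P` is the dual product `G · g` of the distribution `G`
by the smooth function `g`, i.e. `⟨P, t⟩ = ⟨G, g t⟩` for the test functions `t` on `Ξ`. -/
def IsDualProdOn (P G : Distr) (g : ℝ → ℂ) (Ξ : Set ℝ) : Prop :=
  ∃ (hΞ : IsOpen Ξ) (hg : ContDiffOn ℝ ∞ g Ξ),
    ∀ (t : TestFn) (ht : tsupport t ⊆ Ξ), P t = G (mulTest hΞ hg t ht)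

/-- `P` is the Hörmander product `F · G` of two distributions with disjoint singular supports: on
every open set on which one of the factors is a smooth function, `P` is the dual product of the
other factor by that function. (Such open sets cover `ℝ`, so `P` is unique.) -/
def IsHormanderProd (F G P : Distr) : Prop :=
  Disjoint (singSupp F) (singSupp G) ∧
  (∀ (Ξ : Set ℝ) (g : ℝ → ℂ), IsOpen Ξ → IsSmoothOn F g Ξ → IsDualProdOn P G g Ξ) ∧
  (∀ (Ξ : Set ℝ) (g : ℝ → ℂ), IsOpen Ξ → IsSmoothOn G g Ξ → IsDualProdOn P F g Ξ)

/-- `P = F * G`, where `F * G = lim_{ε ↓ 0} F(x) · G(x + ε)`; the product under the limit is the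
Hörmander product and the limit is the limit of distributions (tested on each test function). -/
def IsStarProd (F G P : Distr) : Prop :=
  ∃ Q : ℝ → Distr, (∀ᶠ ε in 𝓝[>] (0 : ℝ), IsHormanderProd F (translate ε G) (Q ε)) ∧
    ∀ t : TestFn, Tendsto (fun ε => Q ε t) (𝓝[>] (0 : ℝ)) (𝓝 (P t))

/-! ### The differential equation -/

/-- `ψ ∈ 𝒜` is a solution of `∑_{i=0}^n (a_i * ψ⁽ⁱ⁾ + ψ⁽ⁱ⁾ * b_i) = f`. -/
def IsSolution {n : ℕ} (a b : Fin (n + 1) → Distr) (f : ℝ → ℂ) (ψ : Distr) : Prop :=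
  ψ ∈ spaceA ∧ ∃ P Q : Fin (n + 1) → Distr,
    (∀ i : Fin (n + 1), IsStarProd (a i) (D^[(i : ℕ)] ψ) (P i)) ∧
    (∀ i : Fin (n + 1), IsStarProd (D^[(i : ℕ)] ψ) (b i) (Q i)) ∧
    ∑ i : Fin (n + 1), (P i + Q i) = reg f

/-- On the open set `Ω`, the distribution `u` satisfies `∑_{i=0}^n c_i u⁽ⁱ⁾ = f` in the sense of
distributions, where the coefficients `c_i` are smooth functions on `Ω`. -/
def SolvesOn {n : ℕ} (c : Fin (n + 1) → ℝ → ℂ) (f : ℝ → ℂ) (Ω : Set ℝ) (u : Distr) : Prop :=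
  ∃ (hΩ : IsOpen Ω) (hc : ∀ i, ContDiffOn ℝ ∞ (c i) Ω),
    ∀ (t : TestFn) (ht : tsupport t ⊆ Ω),
      ∑ i : Fin (n + 1), (D^[(i : ℕ)] u) (mulTest hΩ (hc i) t ht) = ∫ x, f x * t x

/-- The distribution `u` on the open interval `Ω` has the initial data `C` at `x₀ ∈ closure Ω`:
near `x₀` it is a function `g`, smooth up to the boundary of `Ω`, with
`g⁽ʲ⁾(x₀) = C_j` for `j < n` (one-sided derivatives if `x₀` is an end point of `Ω`). -/
def HasInitialData {n : ℕ} (u : Distr) (Ω : Set ℝ) (x₀ : ℝ) (C : Fin n → ℂ) : Prop :=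
  ∃ V : Set ℝ, IsOpen V ∧ x₀ ∈ V ∧ ∃ g : ℝ → ℂ,
    ContDiffOn ℝ ∞ g (V ∩ closure Ω) ∧ EqFunOn u g (V ∩ Ω) ∧
    ∀ j : Fin n, iteratedDerivWithin (j : ℕ) g (V ∩ closure Ω) x₀ = C j

/-- Sectional regularity of the equation `∑_{i=0}^n (a_i * ψ⁽ⁱ⁾ + ψ⁽ⁱ⁾ * b_i) = f`.
Let `Ω` be any open interval of regular points (points outside the singular supports of the
coefficients), and let `α_i`, `β_i` be the smooth functions on `closure Ω` that `a_i`, `b_i` are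
equal to on `Ω`. Then every initial value problem for `∑ (α_i + β_i) ψ⁽ⁱ⁾ = f` at a point of
`closure Ω` has a unique solution, and this solution is smooth on `closure Ω`. Uniqueness refers
to the distributional solutions, i.e. the solutions in `𝒜(Ω) = {u|_Ω : u ∈ 𝒜}`. -/
def SectionallyRegular {n : ℕ} (a b : Fin (n + 1) → Distr) (f : ℝ → ℂ) : Prop :=
  ∀ Ω : Set ℝ, IsOpen Ω → Ω.OrdConnected →
    (∀ i, Disjoint Ω (singSupp (a i)) ∧ Disjoint Ω (singSupp (b i))) →
    ∀ α β : Fin (n + 1) → ℝ → ℂ,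
      (∀ i, ContDiffOn ℝ ∞ (α i) (closure Ω) ∧ EqFunOn (a i) (α i) Ω) →
      (∀ i, ContDiffOn ℝ ∞ (β i) (closure Ω) ∧ EqFunOn (b i) (β i) Ω) →
      ∀ x₀ ∈ closure Ω, ∀ C : Fin n → ℂ,
        ∃ φ : ℝ → ℂ, ContDiffOn ℝ ∞ φ (closure Ω) ∧
          (∀ x ∈ closure Ω,
            ∑ i : Fin (n + 1), (α i x + β i x) * iteratedDerivWithin (i : ℕ) φ (closure Ω) x = f x) ∧
          (∀ j : Fin n, iteratedDerivWithin (j : ℕ) φ (closure Ω) x₀ = C j) ∧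
          ∀ u ∈ spaceA, SolvesOn (fun i x => α i x + β i x) f Ω u →
            HasInitialData u Ω x₀ C → EqFunOn u φ Ω

/-! ### Coefficients that are singular at the origin only -/

/-- The Heaviside function. -/
def H (x : ℝ) : ℂ := if 0 ≤ x then 1 else 0

/-- `H₋ = 1 - H`. -/
def Hminus (x : ℝ) : ℂ := 1 - H x

/-- The regular distribution `H₋ u + H v`. -/
def glue (u v : ℝ → ℂ) : Distr := reg fun x => Hminus x * u x + H x * v x

end

end SingularODE

open SingularODE

namespace SingularODE

noncomputable section

/-! ### Test functions -/

/-! Away from the origin the equation is an ordinary linear one with smooth coefficients. A member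
of `spaceA` is a smooth function on some open subset of each half-line, so `ψ` itself supplies
initial data at a point there, and the uniqueness clause of sectional regularity identifies `ψ` on
the whole half-line with a classical solution smooth up to 0 (`IsSolution.exists_classical`).
Borel's lemma extends the two classical solutions to `ψm` and `ψp` on `ℝ`. The remainder `ψ - glue
ψm ψp` lives at the origin, hence is a finite combination of derivatives of the Dirac measure
(`exists_eq_deltaComb`).

The degree of this combination is bounded by means of an explicit formula for the product
(`IsStarProd.apply_glue`). In `F(x) · G(x + ε)` the singularity of `G` has moved to `-ε`, where `F`
is its left branch, while the singularity of `F` stays at 0, where the shifted `G` is its right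
branch. So in the limit the delta part of `G` is multiplied by the left branch of `F`, and the delta
part of `F` by the right branch of `G`. In the equation the function parts cancel because `ψm` and
`ψp` solve it, leaving an identity between delta parts (`IsSolution.sum_singular_eq_zero`). If the
remainder has top degree `N` with coefficient `d N`, the term of degree `N + n` coming from it is `d
N` times the leading number `a_{n-}(0) + b_{n+}(0)`, which is nonzero; only the delta parts of the
coefficients can cancel it, so their degree must reach `N + n`
(`IsSolution.singular_coeff_eq_zero`).

Degrees are converted into orders by `coeff_eq_zero_of_ord_le` and `ord_deltaComb_le`: the `k`-th
derivative of the Dirac measure counts as order `k + 1`. -/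

theorem TestFn.smooth (t : TestFn) : ContDiff ℝ ∞ t := t.contDiff

/-- The test function with underlying function `g`. -/
def mkTest (g : ℝ → ℂ) (hg : ContDiff ℝ ∞ g) (hc : HasCompactSupport g) : TestFn :=
  ⟨g, hg, hc, fun _ _ => trivial⟩

/-- The product of a test function by a smooth function. -/
def smoothMul (g : ℝ → ℂ) (hg : ContDiff ℝ ∞ g) (t : TestFn) : TestFn :=
  mkTest (fun x => g x * t x) (hg.mul t.smooth) t.hasCompactSupport.mul_left

@[simp] theorem smoothMul_apply (g : ℝ → ℂ) (hg : ContDiff ℝ ∞ g) (t : TestFn) (x : ℝ) :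
    smoothMul g hg t x = g x * t x := rfl

theorem coe_smoothMul (g : ℝ → ℂ) (hg : ContDiff ℝ ∞ g) (t : TestFn) :
    ⇑(smoothMul g hg t) = fun x => g x * t x := rfl

@[simp] theorem mulTest_apply {Ξ : Set ℝ} (hΞ : IsOpen Ξ) {g : ℝ → ℂ} (hg : ContDiffOn ℝ ∞ g Ξ)
    (t : TestFn) (ht : tsupport t ⊆ Ξ) (x : ℝ) : mulTest hΞ hg t ht x = g x * t x := rfl

theorem coe_mulTest {Ξ : Set ℝ} (hΞ : IsOpen Ξ) {g : ℝ → ℂ} (hg : ContDiffOn ℝ ∞ g Ξ)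
    (t : TestFn) (ht : tsupport t ⊆ Ξ) : ⇑(mulTest hΞ hg t ht) = fun x => g x * t x := rfl

@[simp] theorem shiftTest_apply (ε : ℝ) (t : TestFn) (x : ℝ) : shiftTest ε t x = t (x - ε) := rfl

/-- The derivative of a test function. -/
def derivTest (t : TestFn) : TestFn := (TestFunction.lineDerivCLM ℂ (1 : ℝ) : TestFn →L[ℂ] TestFn) t

@[simp] theorem derivTest_apply (t : TestFn) (x : ℝ) : derivTest t x = deriv t x := by
  rw [derivTest, TestFunction.lineDerivCLM_eq_fderivCLM, TestFunction.fderivCLM_apply]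
  simp

theorem coe_derivTest (t : TestFn) : ⇑(derivTest t) = deriv t :=
  funext fun x => derivTest_apply t x

theorem coe_derivTest_iterate (k : ℕ) (t : TestFn) : ⇑(derivTest^[k] t) = iteratedDeriv k t := by
  induction k with
  | zero => simp
  | succ k ih => rw [Function.iterate_succ_apply', coe_derivTest, ih, iteratedDeriv_succ]

theorem D_apply (F : Distr) (t : TestFn) : D F t = -F (derivTest t) := rfl

theorem D_iterate_apply (k : ℕ) (F : Distr) (t : TestFn) :
    (D^[k] F) t = (-1) ^ k * F (derivTest^[k] t) := by
  induction k generalizing t with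
  | zero => simp
  | succ k ih =>
    rw [Function.iterate_succ_apply', D_apply, ih, Function.iterate_succ_apply, pow_succ]
    ring

theorem D_add (F G : Distr) : D (F + G) = D F + D G := by
  ext t; simp only [D_apply, _root_.add_apply]; ring

theorem D_smul (c : ℂ) (F : Distr) : D (c • F) = c • D F := by
  ext t; simp [D_apply]

theorem contDiff_iteratedDeriv {g : ℝ → ℂ} (hg : ContDiff ℝ ∞ g) (k : ℕ) :
    ContDiff ℝ ∞ (iteratedDeriv k g) := by
  rw [iteratedDeriv_eq_iterate]; exact hg.iterate_deriv k

theorem D_iterate_add (k : ℕ) (F G : Distr) : D^[k] (F + G) = D^[k] F + D^[k] G := by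
  ext t; simp only [D_iterate_apply, add_apply]; ring

theorem D_iterate_smul (k : ℕ) (c : ℂ) (F : Distr) : D^[k] (c • F) = c • D^[k] F := by
  ext t; simp only [D_iterate_apply, smul_apply, smul_eq_mul]; ring

/-! ### Regular distributions -/

theorem reg_apply {g : ℝ → ℂ} (hg : LocallyIntegrable g volume) (t : TestFn) :
    reg g t = ∫ x, g x * t x := by
  rw [reg, TestFunction.integralAgainstBilinCLM_eq_integral (hg.locallyIntegrableOn _)]
  simp [mul_comm]

theorem reg_eq_zero {g : ℝ → ℂ} (hg : ¬ LocallyIntegrable g volume) : reg g = 0 := by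
  apply TestFunction.integralAgainstBilinCLM_eq_zero
  simpa [locallyIntegrableOn_univ] using hg

/-- Every distribution `reg g` is `reg h` for a locally integrable `h` that is `g` or `0`. -/
theorem exists_locallyIntegrable_reg_eq (g : ℝ → ℂ) :
    ∃ h : ℝ → ℂ, LocallyIntegrable h volume ∧ reg g = reg h ∧ (h = g ∨ h = 0) := by
  by_cases hg : LocallyIntegrable g volume
  · exact ⟨g, hg, rfl, Or.inl rfl⟩
  · refine ⟨0, locallyIntegrable_zero, ?_, Or.inr rfl⟩
    rw [reg_eq_zero hg]
    ext t
    rw [reg_apply (g := 0) locallyIntegrable_zero]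
    simp

theorem integrable_mul_test {g : ℝ → ℂ} (hg : LocallyIntegrable g volume) (t : TestFn) :
    Integrable (fun x => g x * t x) := by
  have := TestFunction.integrable_bilin (ContinuousLinearMap.mul ℂ ℂ)
    (hg.locallyIntegrableOn ((⊤ : Opens ℝ) : Set ℝ)) t
  simpa [mul_comm] using this

theorem H_of_nonneg {x : ℝ} (hx : 0 ≤ x) : H x = 1 := if_pos hx
theorem H_of_neg {x : ℝ} (hx : x < 0) : H x = 0 := if_neg (not_le.2 hx)
theorem Hminus_of_nonneg {x : ℝ} (hx : 0 ≤ x) : Hminus x = 0 := by simp [Hminus, H_of_nonneg hx]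
theorem Hminus_of_neg {x : ℝ} (hx : x < 0) : Hminus x = 1 := by simp [Hminus, H_of_neg hx]

theorem measurable_H : Measurable H :=
  Measurable.ite measurableSet_Ici measurable_const measurable_const

theorem measurable_Hminus : Measurable Hminus := measurable_const.sub measurable_H

theorem locallyIntegrable_glue {u v : ℝ → ℂ} (hu : Continuous u) (hv : Continuous v) :
    LocallyIntegrable (fun x => Hminus x * u x + H x * v x) volume := by
  have h1 : LocallyIntegrable (fun x => ‖u x‖ + ‖v x‖) volume :=
    (hu.norm.add hv.norm).locallyIntegrable
  refine h1.mono ?_ (Eventually.of_forall fun x => ?_)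
  · exact ((measurable_Hminus.mul hu.measurable).add
      (measurable_H.mul hv.measurable)).aestronglyMeasurable
  · rw [Real.norm_of_nonneg (by positivity)]
    rcases le_or_gt 0 x with h | h
    · simp [H_of_nonneg h, Hminus_of_nonneg h]
    · simp [H_of_neg h, Hminus_of_neg h]

theorem glue_apply {u v : ℝ → ℂ} (hu : Continuous u) (hv : Continuous v) (t : TestFn) :
    glue u v t = ∫ x, (Hminus x * u x + H x * v x) * t x :=
  reg_apply (locallyIntegrable_glue hu hv) t

theorem glue_apply_eq_add {u v : ℝ → ℂ} (hu : Continuous u) (hv : Continuous v) (t : TestFn) :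
    glue u v t = (∫ x in Set.Iic 0, u x * t x) + ∫ x in Set.Ioi 0, v x * t x := by
  rw [glue_apply hu hv,
    ← integral_add_compl (s := Set.Iic (0 : ℝ)) measurableSet_Iic
      (integrable_mul_test (locallyIntegrable_glue hu hv) t), Set.compl_Iic]
  congr 1
  · rw [integral_Iic_eq_integral_Iio, integral_Iic_eq_integral_Iio]
    refine setIntegral_congr_fun measurableSet_Iio fun x hx => ?_
    simp [H_of_neg (Set.mem_Iio.1 hx), Hminus_of_neg (Set.mem_Iio.1 hx)]
  · refine setIntegral_congr_fun measurableSet_Ioi fun x hx => ?_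
    simp [H_of_nonneg (Set.mem_Ioi.1 hx).le, Hminus_of_nonneg (Set.mem_Ioi.1 hx).le]

theorem glue_eqFunOn_Ioi {u v : ℝ → ℂ} (hu : Continuous u) (hv : Continuous v) :
    EqFunOn (glue u v) v (Set.Ioi 0) := by
  intro t ht
  rw [glue_apply hu hv]
  refine integral_congr_ae (Eventually.of_forall fun x => ?_)
  rcases le_or_gt 0 x with h | h
  · simp [H_of_nonneg h, Hminus_of_nonneg h]
  · have : t x = 0 := image_eq_zero_of_notMem_tsupport fun hx => absurd (ht hx) (by simp [h.le])
    simp [this]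

theorem glue_eqFunOn_Iio {u v : ℝ → ℂ} (hu : Continuous u) (hv : Continuous v) :
    EqFunOn (glue u v) u (Set.Iio 0) := by
  intro t ht
  rw [glue_apply hu hv]
  refine integral_congr_ae (Eventually.of_forall fun x => ?_)
  rcases le_or_gt 0 x with h | h
  · have : t x = 0 := image_eq_zero_of_notMem_tsupport fun hx => absurd (ht hx) (by simp [h])
    simp [this]
  · simp [H_of_neg h, Hminus_of_neg h]

/-! ### Combinations of derivatives of the Dirac measure -/

@[simp] theorem delta_apply (t : TestFn) : delta t = t 0 := rfl

theorem D_iterate_delta_apply (k : ℕ) (t : TestFn) :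
    (D^[k] delta) t = (-1) ^ k * iteratedDeriv k t 0 := by
  rw [D_iterate_apply, delta_apply, coe_derivTest_iterate]

theorem deltaComb_apply (c : ℕ →₀ ℂ) (t : TestFn) :
    deltaComb c t = c.sum fun k z => z * ((-1) ^ k * iteratedDeriv k t 0) := by
  rw [deltaComb, Finsupp.sum, Finsupp.sum, _root_.sum_apply]
  simp [D_iterate_delta_apply]

theorem zero_smul_delta (k : ℕ) : (0 : ℂ) • D^[k] delta = 0 := by
  ext t; rw [_root_.smul_apply, smul_eq_mul, zero_mul]; rfl

theorem deltaComb_zero : deltaComb 0 = 0 := by simp [deltaComb]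

theorem deltaComb_add (c d : ℕ →₀ ℂ) : deltaComb (c + d) = deltaComb c + deltaComb d :=
  Finsupp.sum_add_index' (fun k => zero_smul_delta k) fun k y z => by
    ext t; simp only [_root_.add_apply, _root_.smul_apply, smul_eq_mul]; ring

theorem deltaComb_single (k : ℕ) (z : ℂ) : deltaComb (Finsupp.single k z) = z • D^[k] delta :=
  Finsupp.sum_single_index (zero_smul_delta k)

theorem D_deltaComb (c : ℕ →₀ ℂ) : D (deltaComb c) = deltaComb (c.mapDomain Nat.succ) := by
  induction c using Finsupp.induction_linear with
  | zero => ext t; simp [deltaComb_zero, D_apply]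
  | add c d hc hd => rw [deltaComb_add, D_add, hc, hd, Finsupp.mapDomain_add, deltaComb_add]
  | single k z =>
    rw [deltaComb_single, D_smul, Finsupp.mapDomain_single, deltaComb_single,
      Function.iterate_succ_apply']

theorem deltaComb_congr (c : ℕ →₀ ℂ) {s t : TestFn} (h : s =ᶠ[𝓝 0] t) :
    deltaComb c s = deltaComb c t := by
  simp only [deltaComb_apply, h.iteratedDeriv_eq]

theorem deltaComb_eq_zero_of_tsupport (c : ℕ →₀ ℂ) {t : TestFn} (h : (0 : ℝ) ∉ tsupport t) :
    deltaComb c t = 0 := by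
  rw [deltaComb_congr c (t := 0) (notMem_tsupport_iff_eventuallyEq.1 h), map_zero]

/-! ### Derivatives of regular distributions -/

theorem EqFunOn.mono {F : Distr} {g : ℝ → ℂ} {Ξ Ξ' : Set ℝ} (h : EqFunOn F g Ξ) (hs : Ξ' ⊆ Ξ) :
    EqFunOn F g Ξ' := fun t ht => h t (ht.trans hs)

theorem EqFunOn.deriv {F : Distr} {g : ℝ → ℂ} {Ξ : Set ℝ} (hΞ : IsOpen Ξ)
    (hg : ContDiffOn ℝ ∞ g Ξ) (h : EqFunOn F g Ξ) : EqFunOn (D F) (deriv g) Ξ := by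
  intro t ht
  have ht' : tsupport (derivTest t) ⊆ Ξ := by
    rw [coe_derivTest]; exact (tsupport_deriv_subset (𝕜 := ℝ)).trans ht
  have hg' : ContDiffOn ℝ ∞ (_root_.deriv g) Ξ := hg.deriv_of_isOpen hΞ (by simp)
  rw [D_apply, h _ ht']
  -- The product `g * t` is a test function, so the integral of its derivative vanishes; this is
  -- integration by parts without boundary terms.
  have h0 : ∫ x, _root_.deriv (mulTest hΞ hg t ht) x = 0 :=
    integral_eq_zero_of_hasDerivAt_of_integrable
      (fun x => ((mulTest hΞ hg t ht).smooth.differentiable (by simp) x).hasDerivAt)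
      (by
        rw [← coe_derivTest]
        exact (TestFunction.continuous _).integrable_of_hasCompactSupport
          (TestFunction.hasCompactSupport _))
      ((TestFunction.continuous _).integrable_of_hasCompactSupport
        (TestFunction.hasCompactSupport _))
  have h1 : ∀ x, _root_.deriv (mulTest hΞ hg t ht) x =
      mulTest hΞ hg' t ht x + mulTest hΞ hg (derivTest t) ht' x := by
    intro x
    by_cases hx : x ∈ Ξ
    · rw [coe_mulTest, mulTest_apply, mulTest_apply, derivTest_apply]
      exact deriv_fun_mul (((hg.contDiffAt (hΞ.mem_nhds hx)).differentiableAt (by simp)))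
        (t.smooth.differentiable (by simp) x)
    · have hx' : x ∉ tsupport t := fun h => hx (ht h)
      have h2 : (mulTest hΞ hg t ht : ℝ → ℂ) =ᶠ[𝓝 x] fun _ => 0 := by
        filter_upwards [notMem_tsupport_iff_eventuallyEq.1 hx'] with y hy
        simp [hy]
      rw [h2.deriv_eq, mulTest_apply, mulTest_apply, image_eq_zero_of_notMem_tsupport hx',
        image_eq_zero_of_notMem_tsupport fun h => hx (ht' h)]
      simp
  have hint : ∀ s : TestFn, Integrable s := fun s =>
    (TestFunction.continuous _).integrable_of_hasCompactSupport (TestFunction.hasCompactSupport _)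
  simp_rw [h1] at h0
  rw [integral_add (hint _) (hint _)] at h0
  simp only [mulTest_apply] at h0
  rw [neg_eq_iff_add_eq_zero, add_comm]
  exact h0

theorem EqFunOn.D_iterate {F : Distr} {g : ℝ → ℂ} {Ξ : Set ℝ} (hΞ : IsOpen Ξ)
    (hg : ContDiffOn ℝ ∞ g Ξ) (h : EqFunOn F g Ξ) (k : ℕ) :
    ContDiffOn ℝ ∞ (iteratedDeriv k g) Ξ ∧ EqFunOn (D^[k] F) (iteratedDeriv k g) Ξ := by
  induction k with
  | zero => simpa using ⟨hg, h⟩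
  | succ k ih =>
    rw [Function.iterate_succ_apply', iteratedDeriv_succ]
    exact ⟨ih.1.deriv_of_isOpen hΞ (by simp), ih.2.deriv hΞ ih.1⟩

/-- Integrate by parts on each half-line; the two boundary terms at 0 combine into the jump. -/
theorem D_glue {u v : ℝ → ℂ} (hu : ContDiff ℝ ∞ u) (hv : ContDiff ℝ ∞ v) :
    D (glue u v) = glue (deriv u) (deriv v) + (v 0 - u 0) • delta := by
  ext t
  have hu' : ContDiff ℝ ∞ (deriv u) := (contDiff_infty_iff_deriv.1 hu).2
  have hv' : ContDiff ℝ ∞ (deriv v) := (contDiff_infty_iff_deriv.1 hv).2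
  have hint : ∀ s : TestFn, Integrable s := fun s =>
    (TestFunction.continuous _).integrable_of_hasCompactSupport (TestFunction.hasCompactSupport _)
  have key : ∀ (g : ℝ → ℂ) (hg : ContDiff ℝ ∞ g) (x : ℝ),
      deriv (smoothMul g hg t) x = deriv g x * t x + g x * derivTest t x := by
    intro g hg x
    rw [coe_smoothMul, derivTest_apply]
    exact deriv_fun_mul (hg.differentiable (by simp) x) (t.smooth.differentiable (by simp) x)
  have hI : ∀ (g : ℝ → ℂ) (hg : ContDiff ℝ ∞ g) (S : Set ℝ),
      ∫ x in S, deriv (smoothMul g hg t) x =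
        (∫ x in S, deriv g x * t x) + ∫ x in S, g x * derivTest t x := by
    intro g hg S
    simp_rw [key g hg]
    exact integral_add
      (hint (smoothMul (deriv g) (contDiff_infty_iff_deriv.1 hg).2 t)).integrableOn
      (hint (smoothMul g hg (derivTest t))).integrableOn
  have e1 := (smoothMul u hu t).hasCompactSupport.integral_Iic_deriv_eq
    ((smoothMul u hu t).smooth.of_le (by simp)) 0
  have e2 := (smoothMul v hv t).hasCompactSupport.integral_Ioi_deriv_eq
    ((smoothMul v hv t).smooth.of_le (by simp)) 0
  rw [hI] at e1 e2
  rw [D_apply, glue_apply_eq_add hu.continuous hv.continuous, _root_.add_apply,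
    glue_apply_eq_add hu'.continuous hv'.continuous, _root_.smul_apply, delta_apply, smul_eq_mul]
  rw [smoothMul_apply] at e1 e2
  linear_combination -e1 - e2

/-- The iterated derivatives of a distribution that is piecewise smooth up to a combination of
derivatives of the Dirac measure. -/
theorem D_iterate_glue_add_deltaComb {u v : ℝ → ℂ} (hu : ContDiff ℝ ∞ u) (hv : ContDiff ℝ ∞ v)
    (d : ℕ →₀ ℂ) (i : ℕ) :
    ∃ c : ℕ →₀ ℂ, (∀ k, c (k + i) = d k) ∧
      D^[i] (glue u v + deltaComb d) =
        glue (iteratedDeriv i u) (iteratedDeriv i v) + deltaComb c := by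
  induction i with
  | zero => exact ⟨d, fun _ => rfl, by simp⟩
  | succ i ih =>
    obtain ⟨c, hc, h⟩ := ih
    -- The new jump enters in degree 0 and everything else moves up one degree, so degree `k + (i +
    -- 1)` still carries `d k`; the degrees below `i + 1` hold only jumps.
    refine ⟨Finsupp.single 0 (iteratedDeriv i v 0 - iteratedDeriv i u 0) +
      c.mapDomain Nat.succ, fun k => ?_, ?_⟩
    · rw [← hc k, ← add_assoc, Finsupp.add_apply, Finsupp.single_apply, if_neg (by simp), zero_add]
      exact Finsupp.mapDomain_apply Nat.succ_injective _ _
    · rw [Function.iterate_succ_apply', h, D_add, D_deltaComb,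
        D_glue (contDiff_iteratedDeriv hu i) (contDiff_iteratedDeriv hv i),
        deltaComb_add, deltaComb_single, ← iteratedDeriv_succ, ← iteratedDeriv_succ, add_assoc]
      rfl

/-! ### Continuity of distributions along smooth families of test functions -/

/-- A partial derivative is the total derivative applied to a fixed vector, so joint smoothness
survives. Joint continuity is what later gives uniform convergence of the `x`-derivatives as `ε`
tends to 0. -/
theorem exists_contDiff_iteratedDeriv_snd {Φ : ℝ × ℝ → ℂ} (hΦ : ContDiff ℝ ∞ Φ) (i : ℕ) :
    ∃ Φi : ℝ × ℝ → ℂ, ContDiff ℝ ∞ Φi ∧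
      ∀ ε, iteratedDeriv i (fun y => Φ (ε, y)) = fun x => Φi (ε, x) := by
  induction i with
  | zero => exact ⟨Φ, hΦ, fun ε => by simp⟩
  | succ i ih =>
    obtain ⟨Φi, hi, h⟩ := ih
    refine ⟨fun p => fderiv ℝ Φi p (0, 1), (hi.fderiv_right (by simp)).clm_apply contDiff_const,
      fun ε => ?_⟩
    rw [iteratedDeriv_succ, h]
    funext x
    have h1 : HasDerivAt (fun y : ℝ => (ε, y)) ((0 : ℝ), (1 : ℝ)) x :=
      (hasDerivAt_const x ε).prodMk (hasDerivAt_id x)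
    exact ((hi.differentiable (by simp) (ε, x)).hasFDerivAt.comp_hasDerivAt x h1).deriv

/-- A test function vanishing off the compact set `K`, as an element of `𝓓_K`. -/
def toSupportedIn (K : Compacts ℝ) (t : TestFn) (ht : ∀ x ∉ K, t x = 0) :
    ContDiffMapSupportedIn ℝ ℂ ⊤ K :=
  ⟨t, t.contDiff, fun x hx => ht x hx⟩

/-- For `|ε| ≤ 1` the family stays in a single `𝓓_K`, on which `F` is continuous for the seminorms
of uniform convergence of derivatives; compactness of `K` makes each derivative converge uniformly.
-/
theorem tendsto_apply_of_contDiff (F : Distr) {Φ : ℝ × ℝ → ℂ} (hΦ : ContDiff ℝ ∞ Φ)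
    {T : ℝ → TestFn} (hT : ∀ ε x, T ε x = Φ (ε, x)) {K : Set ℝ} (hK : IsCompact K)
    (hTK : ∀ ε, |ε| ≤ 1 → ∀ x ∉ K, T ε x = 0) :
    Tendsto (fun ε => F (T ε)) (𝓝 0) (𝓝 (F (T 0))) := by
  classical
  let K' : Compacts ℝ := ⟨K, hK⟩
  -- The value 0 for `|ε| > 1` is a dummy; only small `ε` matter.
  let S : ℝ → ContDiffMapSupportedIn ℝ ℂ ⊤ K' := fun ε =>
    if h : |ε| ≤ 1 then toSupportedIn K' (T ε) (hTK ε h) else 0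
  have hev : ∀ᶠ ε : ℝ in 𝓝 0, |ε| ≤ 1 := by
    filter_upwards [Metric.closedBall_mem_nhds (0 : ℝ) one_pos] with ε hε
    simpa using hε
  let L : ContDiffMapSupportedIn ℝ ℂ ⊤ K' →L[ℂ] ℂ :=
    F ∘L TestFunction.ofSupportedInCLM ℂ (Ω := (⊤ : Opens ℝ)) (fun _ _ => trivial)
  have hS : Tendsto S (𝓝 0) (𝓝 (S 0)) := by
    rw [(ContDiffMapSupportedIn.withSeminorms ℂ ℝ ℂ ⊤ K').tendsto_nhds]
    intro i δ hδ
    obtain ⟨Φi, hi, h⟩ := exists_contDiff_iteratedDeriv_snd hΦ i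
    have hu : ∀ᶠ ε in 𝓝 (0 : ℝ), ∀ x ∈ K, ‖Φi (ε, x) - Φi (0, x)‖ < δ / 2 := by
      refine hK.eventually_forall_of_forall_eventually fun x _ => ?_
      have hc : Continuous fun z : ℝ × ℝ => ‖Φi (z.1, z.2) - Φi (0, z.2)‖ := by
        have := hi.continuous; fun_prop
      exact hc.continuousAt.eventually_lt continuousAt_const (by simpa using hδ)
    filter_upwards [hev, hu] with ε h1 h2
    refine lt_of_le_of_lt ?_ (half_lt_self hδ)
    rw [ContDiffMapSupportedIn.seminorm_top_le_iff ℂ (by positivity)]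
    intro x hx
    have e : ⇑(S ε - S 0) = ⇑(T ε) - ⇑(T 0) := by
      simp only [S, dif_pos h1, abs_zero, zero_le_one, dif_pos]
      rfl
    have e' : ∀ ε, ⇑(T ε) = fun x => Φ (ε, x) := fun ε => funext (hT ε)
    rw [e, norm_iteratedFDeriv_eq_norm_iteratedDeriv,
      iteratedDeriv_sub ((T ε).smooth.of_le (by exact_mod_cast le_top)).contDiffAt
        ((T 0).smooth.of_le (by exact_mod_cast le_top)).contDiffAt, e', e', h, h]
    exact (h2 x hx).le
  have := (L.continuous.tendsto _).comp hS
  have h0 : L (S 0) = F (T 0) := by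
    simp only [S, abs_zero, zero_le_one, dif_pos]; rfl
  rw [h0] at this
  refine this.congr' ?_
  filter_upwards [hev] with ε h1
  simp only [S, Function.comp, dif_pos h1]; rfl

theorem contDiff_comp_add {g : ℝ → ℂ} (hg : ContDiff ℝ ∞ g) (ε : ℝ) :
    ContDiff ℝ ∞ fun x => g (x + ε) := hg.comp (contDiff_id.add contDiff_const)

theorem tendsto_apply_smoothMul_comp_add (F : Distr) {g : ℝ → ℂ} (hg : ContDiff ℝ ∞ g)
    (t : TestFn) :
    Tendsto (fun ε => F (smoothMul (fun x => g (x + ε)) (contDiff_comp_add hg ε) t)) (𝓝[>] 0)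
      (𝓝 (F (smoothMul g hg t))) := by
  have := tendsto_apply_of_contDiff F (Φ := fun p => g (p.2 + p.1) * t p.2)
    ((hg.comp (contDiff_snd.add contDiff_fst)).mul (t.smooth.comp contDiff_snd))
    (T := fun ε => smoothMul (fun x => g (x + ε)) (contDiff_comp_add hg ε) t) (fun _ _ => rfl)
    t.hasCompactSupport
    (fun ε _ x hx => by simp [image_eq_zero_of_notMem_tsupport hx])
  simp only [add_zero] at this
  exact this.mono_left nhdsWithin_le_nhds

theorem tendsto_translate_apply (F : Distr) (t : TestFn) :
    Tendsto (fun ε => translate ε F t) (𝓝[>] 0) (𝓝 (F t)) := by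
  have := tendsto_apply_of_contDiff F (Φ := fun p => t (p.2 - p.1))
    (t.smooth.comp (contDiff_snd.sub contDiff_fst))
    (T := fun ε => shiftTest ε t) (fun _ _ => rfl)
    (t.hasCompactSupport.isCompact.cthickening (r := 1))
    (fun ε hε x hx => by
      rw [shiftTest_apply]
      refine image_eq_zero_of_notMem_tsupport fun h => hx ?_
      refine Metric.mem_cthickening_of_dist_le x (x - ε) 1 _ h ?_
      simpa [Real.dist_eq] using hε)
  have h0 : shiftTest 0 t = t := TestFunction.ext fun x => by simp
  rw [h0] at this
  exact this.mono_left nhdsWithin_le_nhds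

/-! ### The product `*` where one factor is smooth -/

theorem IsHormanderProd.apply_left {F G P : Distr} (h : IsHormanderProd F G P) {f : ℝ → ℂ}
    (hf : ContDiff ℝ ∞ f) {Ξ : Set ℝ} (hΞ : IsOpen Ξ) (hF : EqFunOn F f Ξ) {t : TestFn}
    (ht : tsupport t ⊆ Ξ) : P t = G (smoothMul f hf t) := by
  obtain ⟨_, _, h'⟩ := h.2.1 Ξ f hΞ ⟨hf.contDiffOn, hF⟩
  exact h' t ht

theorem IsHormanderProd.apply_right {F G P : Distr} (h : IsHormanderProd F G P) {g : ℝ → ℂ}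
    (hg : ContDiff ℝ ∞ g) {Ξ : Set ℝ} (hΞ : IsOpen Ξ) (hG : EqFunOn G g Ξ) {t : TestFn}
    (ht : tsupport t ⊆ Ξ) : P t = F (smoothMul g hg t) := by
  obtain ⟨_, _, h'⟩ := h.2.2 Ξ g hΞ ⟨hg.contDiffOn, hG⟩
  exact h' t ht

theorem EqFunOn.translate {G : Distr} {g : ℝ → ℂ} {Ξ : Set ℝ} (h : EqFunOn G g Ξ) (ε : ℝ) :
    EqFunOn (translate ε G) (fun x => g (x + ε)) {x | x + ε ∈ Ξ} := by
  intro t ht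
  have hs : tsupport (shiftTest ε t) ⊆ Ξ := by
    have h1 : tsupport (shiftTest ε t) ⊆ (fun x => x - ε) ⁻¹' tsupport t :=
      closure_minimal (fun x hx => subset_tsupport _ hx)
        ((isClosed_tsupport _).preimage (continuous_id.sub continuous_const))
    exact h1.trans fun x hx => by simpa using ht hx
  rw [SingularODE.translate, ContinuousLinearMap.comp_apply, h _ hs,
    ← integral_add_right_eq_self _ ε]
  simp

/-- The first factor is not shifted, so before the limit the product on `Ξ` is already `f` times the
translate of `G`, and translates converge to `G`. -/
theorem IsStarProd.apply_left {F G P : Distr} (h : IsStarProd F G P) {f : ℝ → ℂ}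
    (hf : ContDiff ℝ ∞ f) {Ξ : Set ℝ} (hΞ : IsOpen Ξ) (hF : EqFunOn F f Ξ) {t : TestFn}
    (ht : tsupport t ⊆ Ξ) : P t = G (smoothMul f hf t) := by
  obtain ⟨Q, hQ, hlim⟩ := h
  refine tendsto_nhds_unique (hlim t) ?_
  refine (tendsto_translate_apply G (smoothMul f hf t)).congr' ?_
  filter_upwards [hQ] with ε hε
  exact (hε.apply_left hf hΞ hF ht).symm

theorem IsStarProd.apply_right {F G P : Distr} (h : IsStarProd F G P) {g : ℝ → ℂ}
    (hg : ContDiff ℝ ∞ g) {Ξ : Set ℝ} (hΞ : IsOpen Ξ) (hG : EqFunOn G g Ξ) {t : TestFn}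
    (ht : tsupport t ⊆ Ξ) : P t = F (smoothMul g hg t) := by
  obtain ⟨Q, hQ, hlim⟩ := h
  refine tendsto_nhds_unique (hlim t) ?_
  refine (tendsto_apply_smoothMul_comp_add F hg t).congr' ?_
  -- The shifted factor is smooth only on the shifted set; by compactness that set still contains
  -- the support of `t` for small `ε`.
  have hev : ∀ᶠ ε : ℝ in 𝓝 0, ∀ x ∈ tsupport t, x + ε ∈ Ξ := by
    refine t.hasCompactSupport.isCompact.eventually_forall_of_forall_eventually fun x hx => ?_
    have hc : Continuous fun z : ℝ × ℝ => z.2 + z.1 := by fun_prop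
    exact hc.continuousAt.eventually_mem (hΞ.mem_nhds (by simpa using ht hx))
  filter_upwards [hQ, nhdsWithin_le_nhds hev] with ε hε h1
  exact (hε.apply_right (contDiff_comp_add hg ε)
    (hΞ.preimage (continuous_id.add continuous_const)) (hG.translate ε) h1).symm

/-! ### The product `*` of distributions that are singular at the origin only -/

/-- A smooth cutoff, `0` for `x ≤ -2ε/3` and `1` for `x ≥ -ε/3`. -/
def cut (ε x : ℝ) : ℂ := (Real.smoothTransition (3 * x / ε + 2) : ℂ)

theorem contDiff_cut (ε : ℝ) : ContDiff ℝ ∞ (cut ε) :=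
  Complex.ofRealCLM.contDiff.comp (Real.smoothTransition.contDiff.comp
    (((contDiff_const.mul contDiff_id).div_const ε).add contDiff_const))

theorem cut_eq_zero {ε x : ℝ} (hε : 0 < ε) (hx : x ≤ -2 * ε / 3) : cut ε x = 0 := by
  rw [cut, Real.smoothTransition.zero_of_nonpos, Complex.ofReal_zero]
  rw [← le_neg_iff_add_nonpos_right, div_le_iff₀ hε]; linarith

theorem cut_eq_one {ε x : ℝ} (hε : 0 < ε) (hx : -ε / 3 ≤ x) : cut ε x = 1 := by
  rw [cut, Real.smoothTransition.one_of_one_le, Complex.ofReal_one]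
  have : -1 ≤ 3 * x / ε := by rw [le_div_iff₀ hε]; linarith
  linarith

theorem norm_cut_le (ε x : ℝ) : ‖cut ε x‖ ≤ 1 := by
  rw [cut, Complex.norm_real, Real.norm_of_nonneg (Real.smoothTransition.nonneg _)]
  exact Real.smoothTransition.le_one _

theorem norm_one_sub_cut_le (ε x : ℝ) : ‖1 - cut ε x‖ ≤ 1 := by
  rw [cut, ← Complex.ofReal_one, ← Complex.ofReal_sub, Complex.norm_real,
    Real.norm_of_nonneg (sub_nonneg.2 (Real.smoothTransition.le_one _))]
  linarith [Real.smoothTransition.nonneg (3 * x / ε + 2)]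

theorem norm_glue_fun_le (u v : ℂ) (x : ℝ) : ‖Hminus x * u + H x * v‖ ≤ ‖u‖ + ‖v‖ := by
  rcases le_or_gt 0 x with h | h
  · simp [H_of_nonneg h, Hminus_of_nonneg h]
  · simp [H_of_neg h, Hminus_of_neg h]

theorem eventually_pos_and_le_one : ∀ᶠ ε : ℝ in 𝓝[>] 0, 0 < ε ∧ ε ≤ 1 := by
  filter_upwards [self_mem_nhdsWithin, nhdsWithin_le_nhds (Iic_mem_nhds one_pos)] with ε h1 h2
  exact ⟨h1, h2⟩

theorem exists_norm_comp_add_le {g : ℝ → ℂ} (hg : Continuous g) {K : Set ℝ} (hK : IsCompact K) :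
    ∃ B, ∀ x ∈ K, ∀ ε : ℝ, 0 < ε ∧ ε ≤ 1 → ‖g (x + ε)‖ ≤ B := by
  obtain ⟨B, hB⟩ := (hK.prod (isCompact_Icc (a := (0 : ℝ)) (b := 1))).exists_bound_of_continuousOn
    (f := fun p : ℝ × ℝ => g (p.1 + p.2)) (by fun_prop)
  exact ⟨B, fun x hx ε hε => hB (x, ε) ⟨hx, hε.1.le, hε.2⟩⟩

/-- Dominated convergence: at a fixed `x < 0` the cutoff is eventually 0, at `x ≥ 0` it is 1, so
only the right branch survives. -/
theorem tendsto_integral_glue_mul_comp_add {u v g : ℝ → ℂ} (hu : Continuous u) (hv : Continuous v)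
    (hg : Continuous g) (t : TestFn) :
    Tendsto (fun ε => ∫ x, (Hminus x * u x + H x * v x) * (g (x + ε) * (cut ε x * t x)))
      (𝓝[>] 0) (𝓝 (∫ x, H x * v x * g x * t x)) := by
  obtain ⟨B, hB⟩ := exists_norm_comp_add_le hg t.hasCompactSupport
  refine tendsto_integral_filter_of_dominated_convergence
    (fun x => (‖u x‖ + ‖v x‖) * (B * ‖t x‖)) (Eventually.of_forall fun ε => ?_) ?_ ?_ ?_
  · have := (contDiff_cut ε).continuous
    have h1 := t.continuous
    exact (((measurable_Hminus.mul hu.measurable).add (measurable_H.mul hv.measurable)).mul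
      (by fun_prop : Continuous fun x => g (x + ε) * (cut ε x * t x)).measurable).aestronglyMeasurable
  · filter_upwards [eventually_pos_and_le_one] with ε hε
    refine Eventually.of_forall fun x => ?_
    by_cases hx : x ∈ tsupport t
    · rw [norm_mul, norm_mul, norm_mul]
      have hB0 : 0 ≤ B := (norm_nonneg _).trans (hB x hx ε hε)
      refine mul_le_mul (norm_glue_fun_le _ _ _) ?_ (by positivity) (by positivity)
      refine mul_le_mul (hB x hx ε hε) ?_ (by positivity) hB0
      exact mul_le_of_le_one_left (norm_nonneg _) (norm_cut_le _ _)
    · simp [image_eq_zero_of_notMem_tsupport hx]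
  · refine Continuous.integrable_of_hasCompactSupport
      (by have h1 := t.continuous; fun_prop) ?_
    exact (t.hasCompactSupport.norm.mul_left (f := fun _ => B)).mul_left
  · refine Eventually.of_forall fun x => ?_
    rcases le_or_gt 0 x with h | h
    · have hc : Tendsto (fun ε => v x * (g (x + ε) * t x)) (𝓝[>] 0) (𝓝 (v x * (g (x + 0) * t x))) :=
        ((by fun_prop : Continuous fun ε => v x * (g (x + ε) * t x)).tendsto 0).mono_left
          nhdsWithin_le_nhds
      rw [add_zero, ← mul_assoc] at hc
      simp only [H_of_nonneg h, Hminus_of_nonneg h, one_mul, zero_mul, zero_add]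
      refine hc.congr' ?_
      filter_upwards [self_mem_nhdsWithin] with ε hε
      rw [cut_eq_one hε (by linarith [Set.mem_Ioi.1 hε]), one_mul]
    · simp only [H_of_neg h, Hminus_of_neg h, one_mul, zero_mul, add_zero]
      refine tendsto_const_nhds.congr' ?_
      filter_upwards [self_mem_nhdsWithin,
        nhdsWithin_le_nhds (Iio_mem_nhds (neg_pos.2 h))] with ε hε h1
      rw [cut_eq_zero hε (by linarith [Set.mem_Iio.1 h1, Set.mem_Ioi.1 hε])]
      simp

/-- The complementary half: `1 - cut ε` kills `x ≥ 0`, and for fixed `x < 0` also `x + ε < 0`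
eventually, so only the left branch survives. -/
theorem tendsto_integral_glue_comp_add_mul {u v f : ℝ → ℂ} (hu : Continuous u) (hv : Continuous v)
    (hf : Continuous f) (t : TestFn) :
    Tendsto (fun ε => ∫ x, (Hminus (x + ε) * u (x + ε) + H (x + ε) * v (x + ε)) *
        (f x * ((1 - cut ε x) * t x)))
      (𝓝[>] 0) (𝓝 (∫ x, Hminus x * u x * f x * t x)) := by
  obtain ⟨B, hB⟩ := exists_norm_comp_add_le hu t.hasCompactSupport
  obtain ⟨B', hB'⟩ := exists_norm_comp_add_le hv t.hasCompactSupport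
  refine tendsto_integral_filter_of_dominated_convergence
    (fun x => (B + B') * (‖f x‖ * ‖t x‖)) (Eventually.of_forall fun ε => ?_) ?_ ?_ ?_
  · have := (contDiff_cut ε).continuous
    have h1 := t.continuous
    have h2 : Measurable fun x : ℝ => x + ε := measurable_id.add_const ε
    exact ((((measurable_Hminus.mul hu.measurable).add
      (measurable_H.mul hv.measurable)).comp h2).mul
      (by fun_prop : Continuous
        fun x => f x * ((1 - cut ε x) * t x)).measurable).aestronglyMeasurable
  · filter_upwards [eventually_pos_and_le_one] with ε hε
    refine Eventually.of_forall fun x => ?_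
    by_cases hx : x ∈ tsupport t
    · rw [norm_mul, norm_mul, norm_mul]
      have hB0 : 0 ≤ B := (norm_nonneg _).trans (hB x hx ε hε)
      have hB0' : 0 ≤ B' := (norm_nonneg _).trans (hB' x hx ε hε)
      refine mul_le_mul ((norm_glue_fun_le _ _ _).trans
        (add_le_add (hB x hx ε hε) (hB' x hx ε hε))) ?_ (by positivity) (by positivity)
      refine mul_le_mul_of_nonneg_left ?_ (norm_nonneg _)
      exact mul_le_of_le_one_left (norm_nonneg _) (norm_one_sub_cut_le _ _)
    · simp [image_eq_zero_of_notMem_tsupport hx]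
  · refine Continuous.integrable_of_hasCompactSupport
      (by have h1 := t.continuous; fun_prop) ?_
    exact (t.hasCompactSupport.norm.mul_left (f := fun x => ‖f x‖)).mul_left
  · refine Eventually.of_forall fun x => ?_
    rcases le_or_gt 0 x with h | h
    · simp only [Hminus_of_nonneg h, zero_mul]
      refine tendsto_const_nhds.congr' ?_
      filter_upwards [self_mem_nhdsWithin] with ε hε
      rw [cut_eq_one hε (by linarith [Set.mem_Ioi.1 hε])]
      simp
    · have hc : Tendsto (fun ε => u (x + ε) * (f x * t x)) (𝓝[>] 0) (𝓝 (u (x + 0) * (f x * t x))) :=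
        ((by fun_prop : Continuous fun ε => u (x + ε) * (f x * t x)).tendsto 0).mono_left
          nhdsWithin_le_nhds
      rw [add_zero, ← mul_assoc] at hc
      simp only [Hminus_of_neg h, one_mul]
      refine hc.congr' ?_
      filter_upwards [self_mem_nhdsWithin,
        nhdsWithin_le_nhds (Iio_mem_nhds (neg_pos.2 h))] with ε hε h1
      have h2 : x + ε < 0 := by linarith [Set.mem_Iio.1 h1]
      rw [cut_eq_zero hε (by linarith [Set.mem_Iio.1 h1, Set.mem_Ioi.1 hε]), H_of_neg h2,
        Hminus_of_neg h2]
      simp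

theorem tsupport_smoothMul_subset_of_eq_zero {g : ℝ → ℂ} (hg : ContDiff ℝ ∞ g) (t : TestFn)
    {S : Set ℝ} (hS : IsClosed S) (h : ∀ x ∉ S, g x = 0) : tsupport (smoothMul g hg t) ⊆ S :=
  closure_minimal (fun x hx => by
    by_contra hxS
    exact hx (by simp [h x hxS])) hS

theorem add_deltaComb_eqFunOn {F : Distr} {g : ℝ → ℂ} {Ξ : Set ℝ} (hF : EqFunOn F g Ξ)
    (h0 : (0 : ℝ) ∉ Ξ) (c : ℕ →₀ ℂ) : EqFunOn (F + deltaComb c) g Ξ := by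
  intro t ht
  rw [_root_.add_apply, deltaComb_eq_zero_of_tsupport c (fun h => h0 (ht h)), add_zero, hF t ht]

/-- The value of the product `F * G` of two distributions that are piecewise smooth up to
combinations of derivatives of the Dirac measure. -/
theorem IsStarProd.apply_glue {Fm Fp Gm Gp : ℝ → ℂ} (hFm : ContDiff ℝ ∞ Fm)
    (hFp : ContDiff ℝ ∞ Fp) (hGm : ContDiff ℝ ∞ Gm) (hGp : ContDiff ℝ ∞ Gp) (c d : ℕ →₀ ℂ)
    {P : Distr} (h : IsStarProd (glue Fm Fp + deltaComb c) (glue Gm Gp + deltaComb d) P)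
    (t : TestFn) :
    P t = (∫ x, (Hminus x * (Fm x * Gm x) + H x * (Fp x * Gp x)) * t x) +
      deltaComb d (smoothMul Fm hFm t) + deltaComb c (smoothMul Gp hGp t) := by
  obtain ⟨Q, hQ, hlim⟩ := h
  have hsub : ∀ ε, ContDiff ℝ ∞ fun x => 1 - cut ε x := fun ε =>
    contDiff_const.sub (contDiff_cut ε)
  -- The cutoff changes between the two singularities `-ε` and 0. On the support of `cut ε` the
  -- shifted `G` is the smooth function `Gp (x + ε)`; on the support of `1 - cut ε` the factor `F`
  -- is the smooth function `Fm`.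
  have key : ∀ᶠ ε in 𝓝[>] (0 : ℝ), Q ε t =
      ((∫ x, (Hminus x * Fm x + H x * Fp x) * (Gp (x + ε) * (cut ε x * t x))) +
        deltaComb c (smoothMul (fun x => Gp (x + ε)) (contDiff_comp_add hGp ε) t)) +
      ((∫ x, (Hminus (x + ε) * Gm (x + ε) + H (x + ε) * Gp (x + ε)) *
        (Fm x * ((1 - cut ε x) * t x))) + translate ε (deltaComb d) (smoothMul Fm hFm t)) := by
    filter_upwards [hQ, self_mem_nhdsWithin] with ε hε hpos
    replace hpos : 0 < ε := hpos
    let t1 := smoothMul (cut ε) (contDiff_cut ε) t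
    let t2 := smoothMul (fun x => 1 - cut ε x) (hsub ε) t
    have hsplit : t = t1 + t2 := TestFunction.ext fun x => by
      simp only [t1, t2, _root_.add_apply, smoothMul_apply]; ring
    have e1 : Q ε t1 = (∫ x, (Hminus x * Fm x + H x * Fp x) * (Gp (x + ε) * (cut ε x * t x))) +
        deltaComb c (smoothMul (fun x => Gp (x + ε)) (contDiff_comp_add hGp ε) t) := by
      have hG : EqFunOn (glue Gm Gp + deltaComb d) Gp (Set.Ioi 0) :=
        add_deltaComb_eqFunOn (glue_eqFunOn_Ioi hGm.continuous hGp.continuous) (by simp) d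
      rw [hε.apply_right (contDiff_comp_add hGp ε)
        (isOpen_Ioi.preimage (continuous_id.add continuous_const)) (hG.translate ε)
        ((tsupport_smoothMul_subset_of_eq_zero (contDiff_cut ε) t isClosed_Ici
          (fun x hx => cut_eq_zero hpos (not_le.1 hx).le)).trans fun x hx => by
            have := Set.mem_Ici.1 hx
            change 0 < x + ε
            linarith),
        _root_.add_apply, glue_apply hFm.continuous hFp.continuous]
      congr 1
      -- The cutoff is 1 near 0, so the delta part at 0 does not see it.
      refine deltaComb_congr c ?_
      filter_upwards [Ioi_mem_nhds (show -ε / 3 < 0 by linarith)] with x hx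
      simp [cut_eq_one hpos (Set.mem_Ioi.1 hx).le]
    have e2 : Q ε t2 = (∫ x, (Hminus (x + ε) * Gm (x + ε) + H (x + ε) * Gp (x + ε)) *
        (Fm x * ((1 - cut ε x) * t x))) + translate ε (deltaComb d) (smoothMul Fm hFm t) := by
      have hF : EqFunOn (glue Fm Fp + deltaComb c) Fm (Set.Iio 0) :=
        add_deltaComb_eqFunOn (glue_eqFunOn_Iio hFm.continuous hFp.continuous) (by simp) c
      rw [hε.apply_left hFm isOpen_Iio hF
        ((tsupport_smoothMul_subset_of_eq_zero (hsub ε) t isClosed_Iic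
          (fun x hx => by rw [cut_eq_one hpos (not_le.1 hx).le, sub_self])).trans fun x hx => by
            have := Set.mem_Iic.1 hx
            simp only [Set.mem_Iio]; linarith),
        translate, ContinuousLinearMap.comp_apply, _root_.add_apply,
        glue_apply hGm.continuous hGp.continuous, ← integral_add_right_eq_self _ ε]
      congr 1
      · simp
      · rw [translate, ContinuousLinearMap.comp_apply]
        -- For `x` near 0 the point `x - ε` is left of `-2ε/3`, where the cutoff vanishes.
        refine deltaComb_congr d ?_
        filter_upwards [Iio_mem_nhds (show 0 < ε / 3 by linarith)] with x hx
        simp [cut_eq_zero hpos (show x - ε ≤ -2 * ε / 3 by linarith [Set.mem_Iio.1 hx])]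
    rw [← e1, ← e2, ← map_add, ← hsplit]
  have hl := ((tendsto_integral_glue_mul_comp_add hFm.continuous hFp.continuous hGp.continuous t).add
    (tendsto_apply_smoothMul_comp_add (deltaComb c) hGp t)).add
    ((tendsto_integral_glue_comp_add_mul hGm.continuous hGp.continuous hFm.continuous t).add
    (tendsto_translate_apply (deltaComb d) (smoothMul Fm hFm t)))
  rw [tendsto_nhds_unique (hlim t) (hl.congr' (key.mono fun _ h => h.symm))]
  have hz : Continuous fun _ : ℝ => (0 : ℂ) := continuous_const
  have i1 : Integrable fun x => H x * Fp x * Gp x * t x := by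
    have := integrable_mul_test
      (locallyIntegrable_glue hz (hFp.continuous.mul hGp.continuous)) t
    simpa [mul_assoc] using this
  have i2 : Integrable fun x => Hminus x * Gm x * Fm x * t x := by
    have := integrable_mul_test
      (locallyIntegrable_glue (hGm.continuous.mul hFm.continuous) hz) t
    simpa [mul_assoc] using this
  have : (∫ x, (Hminus x * (Fm x * Gm x) + H x * (Fp x * Gp x)) * t x) =
      (∫ x, Hminus x * Gm x * Fm x * t x) + ∫ x, H x * Fp x * Gp x * t x := by
    rw [← integral_add i2 i1]
    congr 1; funext x; ring
  rw [this]; ring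

/-! ### Test functions with prescribed derivatives at the origin -/

/-- The real bump function underlying `bump`. -/
def realBump : ContDiffBump (0 : ℝ) := ⟨1 / 2, 1, by norm_num, by norm_num⟩

/-- A test function that is `1` near the origin and vanishes off `(-1, 1)`. -/
def bump : TestFn :=
  mkTest (fun x => (realBump x : ℂ)) (Complex.ofRealCLM.contDiff.comp realBump.contDiff)
    (realBump.hasCompactSupport.comp_left (g := ((↑) : ℝ → ℂ)) Complex.ofReal_zero)

theorem bump_apply (x : ℝ) : bump x = (realBump x : ℂ) := rfl

theorem bump_eq_one {x : ℝ} (hx : |x| ≤ 1 / 2) : bump x = 1 := by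
  rw [bump_apply, realBump.one_of_mem_closedBall (by simpa [realBump] using hx),
    Complex.ofReal_one]

theorem bump_eq_zero {x : ℝ} (hx : 1 ≤ |x|) : bump x = 0 := by
  rw [bump_apply, realBump.zero_of_le_dist (by simpa [realBump] using hx),
    Complex.ofReal_zero]

theorem bump_eventuallyEq_one : (bump : ℝ → ℂ) =ᶠ[𝓝 0] fun _ => 1 := by
  filter_upwards [Metric.closedBall_mem_nhds (0 : ℝ) (by norm_num : (0 : ℝ) < 1 / 2)] with x hx
  exact bump_eq_one (by simpa using hx)

/-- The normalized monomial `x ↦ x ^ k / k!`. -/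
def mono (k : ℕ) (x : ℝ) : ℂ := (x : ℂ) ^ k / (k.factorial : ℂ)

theorem contDiff_mono (k : ℕ) : ContDiff ℝ ∞ (mono k) :=
  (Complex.ofRealCLM.contDiff.pow k).div_const _

theorem deriv_mono_zero : deriv (mono 0) = 0 := by
  funext x
  have : mono 0 = fun _ => 1 := by funext x; simp [mono]
  simp [this]

theorem deriv_mono_succ (k : ℕ) : deriv (mono (k + 1)) = mono k := by
  funext x
  have h1 : HasDerivAt (fun x : ℝ => (x : ℂ)) 1 x := Complex.ofRealCLM.hasDerivAt
  have h := ((h1.pow (k + 1)).div_const ((k + 1).factorial : ℂ)).deriv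
  refine h.trans ?_
  have h2 : ((k : ℂ) + 1) ≠ 0 := by exact_mod_cast Nat.succ_ne_zero k
  have h3 : (k.factorial : ℂ) ≠ 0 := by exact_mod_cast k.factorial_ne_zero
  simp only [mono, Nat.factorial_succ]
  push_cast
  simp only [mul_one]
  field_simp

theorem iteratedDeriv_mono_zero (j k : ℕ) : iteratedDeriv j (mono k) 0 = if j = k then 1 else 0 := by
  induction j generalizing k with
  | zero =>
    rcases k with _ | k
    · simp [mono]
    · simp [mono]
  | succ j ih =>
    rw [iteratedDeriv_succ']
    rcases k with _ | k
    · rw [deriv_mono_zero, if_neg (by simp)]; exact iteratedDeriv_const_zero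
    · rw [deriv_mono_succ, ih]; simp

/-- A test function equal to `x ^ k / k!` near the origin. -/
def jet (k : ℕ) : TestFn := smoothMul (mono k) (contDiff_mono k) bump

/-- Up to sign, the jets are a dual family to the derivatives of the Dirac measure; they serve to
read off coefficients. -/
theorem iteratedDeriv_jet (j k : ℕ) : iteratedDeriv j (jet k) 0 = if j = k then 1 else 0 := by
  rw [← iteratedDeriv_mono_zero]
  refine Filter.EventuallyEq.iteratedDeriv_eq j ?_
  filter_upwards [bump_eventuallyEq_one] with x hx
  simp [jet, hx]

theorem exists_bound_iteratedDeriv (t : TestFn) (m : ℕ) :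
    ∃ E, 0 ≤ E ∧ ∀ j ≤ m, ∀ x, ‖iteratedDeriv j t x‖ ≤ E := by
  have h : ∀ j, ∃ E, ∀ x, ‖iteratedDeriv j t x‖ ≤ E := fun j => by
    rw [← coe_derivTest_iterate]
    exact (TestFunction.continuous _).bounded_above_of_compact_support
      (TestFunction.hasCompactSupport _)
  choose E hE using h
  have h0 : ∀ j, 0 ≤ E j := fun j => (norm_nonneg _).trans (hE j 0)
  refine ⟨∑ j ∈ Finset.range (m + 1), E j, Finset.sum_nonneg fun j _ => h0 j, fun j hj x => ?_⟩
  exact (hE j x).trans (Finset.single_le_sum (f := E) (fun j _ => h0 j)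
    (Finset.mem_range.2 (Nat.lt_succ_of_le hj)))

/-- Taylor's estimate by induction: a bound of order `r` on the derivative integrates to order `r +
1` through the mean value inequality. -/
theorem exists_norm_le_mul_abs_pow {g : ℝ → ℂ} (hg : ContDiff ℝ ∞ g) (r : ℕ)
    (h0 : ∀ j < r, iteratedDeriv j g 0 = 0) :
    ∃ A, 0 ≤ A ∧ ∀ x, |x| ≤ 1 → ‖g x‖ ≤ A * |x| ^ r := by
  induction r generalizing g with
  | zero =>
    obtain ⟨A, hA⟩ := (isCompact_closedBall (0 : ℝ) 1).exists_bound_of_continuousOn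
      hg.continuous.continuousOn
    refine ⟨A, (norm_nonneg _).trans (hA 0 (by simp)), fun x hx => ?_⟩
    simpa using hA x (by simpa using hx)
  | succ r ih =>
    obtain ⟨A, hA0, hA⟩ := ih (contDiff_infty_iff_deriv.1 hg).2 fun j hj => by
      rw [← iteratedDeriv_succ']; exact h0 (j + 1) (by omega)
    refine ⟨A, hA0, fun x hx => ?_⟩
    have h := (convex_closedBall (0 : ℝ) |x|).norm_image_sub_le_of_norm_deriv_le (𝕜 := ℝ)
      (f := g) (C := A * |x| ^ r) (x := 0) (y := x)
      (fun y _ => hg.differentiable (by simp) y)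
      (fun y hy => by
        have hy' : |y| ≤ |x| := by simpa using hy
        exact (hA y (hy'.trans hx)).trans (by gcongr))
      (by simp) (by simp)
    have hg0 : g 0 = 0 := by simpa using h0 0 (by omega)
    rw [hg0, sub_zero, sub_zero, Real.norm_eq_abs] at h
    rw [pow_succ, ← mul_assoc]
    exact h

/-! ### Distributions supported at the origin -/

/-- Continuity on `𝓓_K` with `K = [-1, 1]` means domination by finitely many seminorms; `m` is the
largest index among them. -/
theorem exists_order_bound (F : Distr) :
    ∃ (m : ℕ) (C : ℝ), 0 ≤ C ∧ ∀ (t : TestFn) (B : ℝ), (∀ x ∉ Set.Icc (-1 : ℝ) 1, t x = 0) →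
      (∀ i ≤ m, ∀ x, ‖iteratedDeriv i t x‖ ≤ B) → ‖F t‖ ≤ C * B := by
  let K : Compacts ℝ := ⟨Set.Icc (-1) 1, isCompact_Icc⟩
  let L : ContDiffMapSupportedIn ℝ ℂ ⊤ K →L[ℂ] ℂ :=
    F ∘L TestFunction.ofSupportedInCLM ℂ (Ω := (⊤ : Opens ℝ)) (fun _ _ => trivial)
  obtain ⟨s, C, -, hC⟩ := Seminorm.bound_of_continuous
    (ContDiffMapSupportedIn.withSeminorms ℂ ℝ ℂ ⊤ K)
    ((normSeminorm ℂ ℂ).comp L.toLinearMap) (continuous_norm.comp L.continuous)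
  refine ⟨s.sup id, C, C.2, fun t B ht hB => ?_⟩
  have hB0 : 0 ≤ B := (norm_nonneg _).trans (hB 0 (Nat.zero_le _) 0)
  refine (hC (toSupportedIn K t ht)).trans ?_
  rw [_root_.smul_apply, NNReal.smul_def, smul_eq_mul]
  refine mul_le_mul_of_nonneg_left ?_ C.2
  refine Seminorm.finset_sup_apply_le hB0 fun i hi => ?_
  rw [ContDiffMapSupportedIn.seminorm_top_le_iff ℂ hB0]
  intro x _
  rw [norm_iteratedFDeriv_eq_norm_iteratedDeriv]
  exact hB i (Finset.le_sup (f := id) hi) x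

theorem iteratedDeriv_eq_zero_of_notMem_tsupport {g : ℝ → ℂ} {x : ℝ} (hx : x ∉ tsupport g) (i : ℕ) :
    iteratedDeriv i g x = 0 := by
  rw [(notMem_tsupport_iff_eventuallyEq.1 hx).iteratedDeriv_eq]
  exact iteratedDeriv_const_zero

theorem contDiff_bump_scale (ε : ℝ) : ContDiff ℝ ∞ fun x => bump (ε * x) :=
  bump.smooth.comp (contDiff_const.mul contDiff_id)

/-- In the Leibniz rule, `j` derivatives on the cutoff cost `ε⁻¹ ^ j`, while the `(i - j)`-th
derivative of `t` is `O(ε ^ (m + 1 - (i - j)))` on `|x| ≤ ε`. The product is `O(ε ^ (m + 1 - i))`,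
hence `O(ε)`. -/
theorem exists_bound_iteratedDeriv_cutoff (t : TestFn) (m : ℕ)
    (h0 : ∀ j ≤ m, iteratedDeriv j t 0 = 0) :
    ∃ C, ∀ ε : ℝ, 0 < ε → ε ≤ 1 → ∀ i ≤ m, ∀ x,
      ‖iteratedDeriv i (smoothMul _ (contDiff_bump_scale ε⁻¹) t) x‖ ≤ C * ε := by
  obtain ⟨E, hE0, hE⟩ := exists_bound_iteratedDeriv bump m
  have h : ∀ l, ∃ A, 0 ≤ A ∧ ∀ x, |x| ≤ 1 → ‖iteratedDeriv l t x‖ ≤ A * |x| ^ (m + 1 - l) := by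
    intro l
    refine exists_norm_le_mul_abs_pow (contDiff_iteratedDeriv t.smooth l) _ fun j hj => ?_
    have : iteratedDeriv j (iteratedDeriv l t) = iteratedDeriv (j + l) t := by
      simp only [iteratedDeriv_eq_iterate, Function.iterate_add_apply]
    rw [this]
    exact h0 _ (by omega)
  choose A hA0 hA using h
  set A' := ∑ l ∈ Finset.range (m + 1), A l with hA'
  have hA'0 : 0 ≤ A' := Finset.sum_nonneg fun l _ => hA0 l
  refine ⟨2 ^ m * (E * A'), fun ε hε hε1 i hi x => ?_⟩
  by_cases hx : x ∈ tsupport (smoothMul _ (contDiff_bump_scale ε⁻¹) t)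
  · have hxε : |x| ≤ ε := by
      have hcl : IsClosed {x : ℝ | |x| ≤ ε} := isClosed_le continuous_abs continuous_const
      have := tsupport_smoothMul_subset_of_eq_zero (contDiff_bump_scale ε⁻¹) t hcl
        (fun x hx => bump_eq_zero (by
          have hx' : ε < |x| := not_le.1 hx
          rw [abs_mul, abs_of_pos (inv_pos.2 hε), inv_mul_eq_div, le_div_iff₀ hε]
          linarith)) hx
      exact this
    rw [coe_smoothMul, iteratedDeriv_fun_mul
      ((contDiff_bump_scale ε⁻¹).of_le (by exact_mod_cast le_top)).contDiffAt
      (t.smooth.of_le (by exact_mod_cast le_top)).contDiffAt]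
    have hterm : ∀ j ∈ Finset.range (i + 1),
        ‖(i.choose j : ℂ) * iteratedDeriv j (fun x => bump (ε⁻¹ * x)) x * iteratedDeriv (i - j) t x‖
          ≤ i.choose j * (E * A' * ε) := by
      intro j hj
      have hji : j ≤ i := Nat.lt_succ_iff.1 (Finset.mem_range.1 hj)
      rw [iteratedDeriv_comp_const_smul (bump.smooth.of_le (by exact_mod_cast le_top)), norm_mul,
        norm_mul, Complex.norm_natCast, norm_smul, norm_pow, Real.norm_of_nonneg (by positivity),
        mul_assoc]
      refine mul_le_mul_of_nonneg_left ?_ (Nat.cast_nonneg _)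
      have e1 : ‖iteratedDeriv j bump (ε⁻¹ * x)‖ ≤ E := hE j (hji.trans hi) _
      have e2 : ‖iteratedDeriv (i - j) t x‖ ≤ A' * ε ^ (m + 1 - (i - j)) := by
        refine (hA (i - j) x (hxε.trans hε1)).trans ?_
        refine mul_le_mul ?_ (by gcongr) (by positivity) hA'0
        exact Finset.single_le_sum (f := A) (fun l _ => hA0 l) (Finset.mem_range.2 (by omega))
      have e3 : ε⁻¹ ^ j * ε ^ (m + 1 - (i - j)) ≤ ε := by
        have : m + 1 - (i - j) = j + (m + 1 - i) := by omega
        rw [this, pow_add, ← mul_assoc, ← mul_pow, inv_mul_cancel₀ hε.ne', one_pow, one_mul]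
        exact pow_le_of_le_one hε.le hε1 (by omega)
      calc ε⁻¹ ^ j * ‖iteratedDeriv j bump (ε⁻¹ * x)‖ * ‖iteratedDeriv (i - j) t x‖
          ≤ ε⁻¹ ^ j * E * (A' * ε ^ (m + 1 - (i - j))) := by gcongr
        _ = E * A' * (ε⁻¹ ^ j * ε ^ (m + 1 - (i - j))) := by ring
        _ ≤ E * A' * ε := by gcongr
    refine (norm_sum_le_of_le _ hterm).trans ?_
    rw [← Finset.sum_mul, ← Nat.cast_sum, Nat.sum_range_choose]
    push_cast
    calc (2 : ℝ) ^ i * (E * A' * ε) ≤ 2 ^ m * (E * A' * ε) := by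
          gcongr
          · norm_num
      _ = 2 ^ m * (E * A') * ε := by ring
  · rw [iteratedDeriv_eq_zero_of_notMem_tsupport hx, norm_zero]
    positivity

/-- A distribution supported at the origin is a combination of derivatives of the Dirac measure. -/
theorem exists_eq_deltaComb {F : Distr} (hF : ∀ t : TestFn, (0 : ℝ) ∉ tsupport t → F t = 0) :
    ∃ d : ℕ →₀ ℂ, F = deltaComb d := by
  obtain ⟨m, C, hC0, hC⟩ := exists_order_bound F
  -- Only the germ of `t` at 0 matters, so `t` may be cut off at scale `ε`; the finite order of `F`
  -- then makes `F t` of size `O(ε)`.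
  have hker : ∀ t : TestFn, (∀ j ≤ m, iteratedDeriv j t 0 = 0) → F t = 0 := by
    intro t h0
    obtain ⟨C', hC'⟩ := exists_bound_iteratedDeriv_cutoff t m h0
    have hbound : ∀ ε : ℝ, 0 < ε → ε ≤ 1 → ‖F t‖ ≤ C * (C' * ε) := by
      intro ε hε hε1
      set s := smoothMul _ (contDiff_bump_scale ε⁻¹) t with hs
      have hts : F t = F s := by
        rw [← sub_eq_zero, ← map_sub]
        refine hF _ ?_
        rw [notMem_tsupport_iff_eventuallyEq]
        have hc : Tendsto (fun x : ℝ => ε⁻¹ * x) (𝓝 0) (𝓝 0) :=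
          (by fun_prop : Continuous fun x : ℝ => ε⁻¹ * x).tendsto' 0 0 (by simp)
        filter_upwards [hc.eventually bump_eventuallyEq_one] with x hx
        simp [hs, hx]
      rw [hts]
      refine hC s _ (fun x hx => ?_) (hC' ε hε hε1)
      have hx1 : 1 < |x| := by
        by_contra h
        exact hx (abs_le.1 (not_lt.1 h))
      rw [hs, smoothMul_apply, bump_eq_zero, zero_mul]
      rw [abs_mul, abs_of_pos (inv_pos.2 hε), inv_mul_eq_div, le_div_iff₀ hε]
      linarith
    have hlim : Tendsto (fun ε : ℝ => C * (C' * ε)) (𝓝[>] 0) (𝓝 0) :=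
      ((by fun_prop : Continuous fun ε : ℝ => C * (C' * ε)).tendsto' 0 0 (by simp)).mono_left
        nhdsWithin_le_nhds
    have := ge_of_tendsto hlim (eventually_pos_and_le_one.mono fun ε hε => hbound ε hε.1 hε.2)
    exact norm_le_zero_iff.1 this
  -- A functional vanishing on the common kernel of finitely many functionals is a linear
  -- combination of them.
  have hspan := mem_span_of_iInf_ker_le_ker (ι := Fin (m + 1))
    (L := fun i => ((D^[(i : ℕ)] delta : Distr) : TestFn →ₗ[ℂ] ℂ)) (K := (F : TestFn →ₗ[ℂ] ℂ))
    fun t ht => by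
      refine hker t fun j hj => ?_
      have h1 := (Submodule.mem_iInf _).1 ht ⟨j, by omega⟩
      have h2 : (D^[j] delta) t = 0 := h1
      rw [D_iterate_delta_apply] at h2
      simpa using h2
  obtain ⟨c, hc⟩ := (Submodule.mem_span_range_iff_exists_fun ℂ).1 hspan
  refine ⟨∑ i : Fin (m + 1), Finsupp.single (i : ℕ) (c i), ?_⟩
  ext t
  have hsum : ∀ s : Finset (Fin (m + 1)), deltaComb (∑ i ∈ s, Finsupp.single (i : ℕ) (c i)) =
      ∑ i ∈ s, c i • D^[(i : ℕ)] delta := by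
    intro s
    induction s using Finset.induction_on with
    | empty => simp [deltaComb_zero]
    | insert i s hi ih => rw [Finset.sum_insert hi, Finset.sum_insert hi, deltaComb_add, ih,
        deltaComb_single]
  rw [hsum]
  have := LinearMap.congr_fun hc t
  simpa using this.symm

/-! ### The order of combinations of derivatives of the Dirac measure -/

theorem contDiff_comp_mul (t : TestFn) (r : ℝ) : ContDiff ℝ ∞ fun x => t (r * x) :=
  t.smooth.comp (contDiff_const.mul contDiff_id)

/-- The dilation `x ↦ t (r x)` of a test function. -/
def dilate (r : ℝ) (hr : r ≠ 0) (t : TestFn) : TestFn :=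
  mkTest (fun x => t (r * x)) (contDiff_comp_mul t r)
    (t.hasCompactSupport.comp_homeomorph (Homeomorph.mulLeft₀ r hr))

theorem coe_dilate (r : ℝ) (hr : r ≠ 0) (t : TestFn) : ⇑(dilate r hr t) = fun x => t (r * x) := rfl

theorem iteratedDeriv_comp_mul (t : TestFn) (r : ℝ) (j : ℕ) :
    iteratedDeriv j (fun x => t (r * x)) = fun x => (r : ℂ) ^ j * iteratedDeriv j t (r * x) := by
  rw [iteratedDeriv_comp_const_smul (t.smooth.of_le (by exact_mod_cast le_top))]
  funext x
  rw [Complex.real_smul, Complex.ofReal_pow]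

theorem iteratedDeriv_jet_eq_zero (j k : ℕ) {x : ℝ} (hx : 1 < |x|) :
    iteratedDeriv j (jet k) x = 0 := by
  refine iteratedDeriv_eq_zero_of_notMem_tsupport (fun h => ?_) j
  have hcl : IsClosed {x : ℝ | |x| ≤ 1} := isClosed_le continuous_abs continuous_const
  have h1 : tsupport (jet k) ⊆ {x : ℝ | |x| ≤ 1} := closure_minimal (fun y hy => by
    by_contra hy1
    exact hy (by simp [jet, bump_eq_zero (not_le.1 hy1).le])) hcl
  exact absurd (h1 h) (not_le.2 hx)

theorem deltaComb_dilate_jet (c : ℕ →₀ ℂ) (k : ℕ) (r : ℝ) (hr : r ≠ 0) :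
    deltaComb c (dilate r hr (jet k)) = c k * ((-1) ^ k * (r : ℂ) ^ k) := by
  rw [deltaComb_apply, Finsupp.sum, coe_dilate]
  simp only [iteratedDeriv_comp_mul, mul_zero, iteratedDeriv_jet]
  simp +contextual

/-- The supports shrink to the null set `{0}`, and for `r ≥ 1` a multiple of `‖g‖` on `[-1, 1]`
dominates. -/
theorem tendsto_integral_dilate {g w : ℝ → ℂ} (hg : LocallyIntegrable g volume) (hw : Continuous w)
    (hw0 : ∀ x, 1 < |x| → w x = 0) :
    Tendsto (fun r : ℝ => ∫ x, g x * w (r * x)) atTop (𝓝 0) := by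
  obtain ⟨E, hE⟩ := (isCompact_Icc (a := (-1 : ℝ)) (b := 1)).exists_bound_of_continuousOn
    hw.continuousOn
  have hE' : ∀ x, ‖w x‖ ≤ E := fun x => by
    by_cases hx : |x| ≤ 1
    · exact hE x (abs_le.1 hx)
    · rw [hw0 x (not_le.1 hx), norm_zero]
      exact (norm_nonneg _).trans (hE 0 (by simp))
  have h0 : (0 : ℂ) = ∫ _ : ℝ, (0 : ℂ) := by simp
  rw [h0]
  refine tendsto_integral_filter_of_dominated_convergence
    ((Set.Icc (-1 : ℝ) 1).indicator fun x => ‖g x‖ * E) ?_ ?_ ?_ ?_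
  · refine Eventually.of_forall fun r => hg.aestronglyMeasurable.mul ?_
    exact (hw.comp (continuous_const.mul continuous_id)).aestronglyMeasurable
  · filter_upwards [eventually_ge_atTop 1] with r hr
    refine Eventually.of_forall fun x => ?_
    by_cases hx : |x| ≤ 1
    · rw [Set.indicator_of_mem (Set.mem_Icc.2 (abs_le.1 hx)), norm_mul]
      exact mul_le_mul_of_nonneg_left (hE' _) (norm_nonneg _)
    · rw [Set.indicator_of_notMem (s := Set.Icc (-1 : ℝ) 1) (fun h => hx (abs_le.2 h)), hw0, mul_zero, norm_zero]
      rw [abs_mul, abs_of_pos (by linarith)]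
      nlinarith [not_le.1 hx]
  · refine (integrable_indicator_iff measurableSet_Icc).2 ?_
    exact ((hg.integrableOn_isCompact isCompact_Icc).norm.mul_const E)
  · have : ∀ᵐ x : ℝ, x ≠ 0 := by simp [ae_iff, measure_singleton]
    filter_upwards [this] with x hx
    refine tendsto_const_nhds.congr' ?_
    have hx' : 0 < |x| := abs_pos.2 hx
    filter_upwards [eventually_gt_atTop (1 / |x|), eventually_gt_atTop 0] with r hr hr0
    rw [hw0, mul_zero]
    rw [abs_mul, abs_of_pos hr0]
    exact (div_lt_iff₀ hx').1 hr

/-- Scaling: on the jet of degree `k` dilated by `r`, the left side has modulus `‖c k‖ * r ^ k`,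
whereas the right side is `r ^ m` times an integral tending to 0. For `m ≤ k` this forces `c k = 0`.
-/
theorem coeff_eq_zero_of_eq_D_iterate_reg {c : ℕ →₀ ℂ} {m : ℕ} {g : ℝ → ℂ}
    (hg : LocallyIntegrable g volume) (h : deltaComb c = D^[m] (reg g)) {k : ℕ} (hk : m ≤ k) :
    c k = 0 := by
  have hw : Continuous (iteratedDeriv m (jet k)) :=
    (contDiff_iteratedDeriv (jet k).smooth m).continuous
  have hlim := (tendsto_integral_dilate hg hw fun x hx => iteratedDeriv_jet_eq_zero m k hx).norm
  rw [norm_zero] at hlim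
  refine norm_le_zero_iff.1 (ge_of_tendsto hlim ?_)
  filter_upwards [eventually_ge_atTop 1] with r hr
  have hr0 : 0 < r := by linarith
  have e := congrArg norm (DFunLike.congr_fun h (dilate r hr0.ne' (jet k)))
  rw [deltaComb_dilate_jet, D_iterate_apply, reg_apply hg, coe_derivTest_iterate,
    coe_dilate, iteratedDeriv_comp_mul] at e
  have e2 : ∫ x, g x * ((r : ℂ) ^ m * iteratedDeriv m (jet k) (r * x)) =
      (r : ℂ) ^ m * ∫ x, g x * iteratedDeriv m (jet k) (r * x) := by
    rw [← integral_const_mul]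
    congr 1; funext x; ring
  rw [e2] at e
  simp only [norm_mul, norm_pow, norm_neg, norm_one, one_pow, one_mul, Complex.norm_real,
    Real.norm_of_nonneg hr0.le] at e
  have h1 : r ^ m ≤ r ^ k := pow_le_pow_right₀ hr hk
  have h2 : ‖c k‖ * r ^ k ≤ ‖∫ x, g x * iteratedDeriv m (jet k) (r * x)‖ * r ^ k := by
    rw [e, mul_comm]; gcongr
  exact le_of_mul_le_mul_right h2 (by positivity)

theorem exists_of_ord_le {F : Distr} {m : ℕ} (h : ord F ≤ m) :
    ∃ j ≤ m, ∃ g : ℝ → ℂ, LocallyIntegrable g volume ∧ F = D^[j] (reg g) := by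
  have hne : ((fun k : ℕ => (k : ℕ∞)) ''
      {k : ℕ | ∃ g : ℝ → ℂ, LocallyIntegrable g volume ∧ F = D^[k] (reg g)}).Nonempty := by
    rw [Set.nonempty_iff_ne_empty]
    intro he
    rw [ord, he, sInf_empty] at h
    exact absurd h (by simp)
  obtain ⟨j, hj, hj'⟩ := csInf_mem hne
  refine ⟨j, ?_, hj⟩
  have : (j : ℕ∞) ≤ m := hj'.trans_le h
  exact_mod_cast this

theorem coeff_eq_zero_of_ord_le {c : ℕ →₀ ℂ} {m : ℕ} (h : ord (deltaComb c) ≤ m) {k : ℕ}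
    (hk : m ≤ k) : c k = 0 := by
  obtain ⟨j, hj, g, hg, e⟩ := exists_of_ord_le h
  exact coeff_eq_zero_of_eq_D_iterate_reg hg e (hj.trans hk)

theorem contDiff_zero' : ContDiff ℝ ∞ (0 : ℝ → ℂ) := contDiff_const

theorem reg_add {g h : ℝ → ℂ} (hg : LocallyIntegrable g volume) (hh : LocallyIntegrable h volume) :
    reg (g + h) = reg g + reg h := by
  ext t
  rw [_root_.add_apply, reg_apply (hg.add hh), reg_apply hg, reg_apply hh,
    ← integral_add (integrable_mul_test hg t) (integrable_mul_test hh t)]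
  congr 1; funext x; simp [add_mul]

theorem reg_const_smul {g : ℝ → ℂ} (hg : LocallyIntegrable g volume) (z : ℂ) :
    reg (z • g) = z • reg g := by
  ext t
  rw [_root_.smul_apply, reg_apply (hg.smul z), reg_apply hg, smul_eq_mul, ← integral_const_mul]
  congr 1; funext x; simp [mul_assoc]

theorem reg_zero : reg 0 = 0 := by
  ext t
  rw [reg_apply (g := 0) locallyIntegrable_zero]
  simp

theorem D_zero : D 0 = 0 := by
  ext t; simp [D_apply]

theorem D_iterate_zero (k : ℕ) : D^[k] 0 = 0 := Function.iterate_fixed D_zero k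

/-- Each derivative lowers the monomial by one degree without a jump, until the Heaviside function
is left and its jump gives the Dirac measure. -/
theorem D_iterate_glue_mono (j : ℕ) : D^[j + 1] (glue 0 (mono j)) = delta := by
  have hz : deriv (0 : ℝ → ℂ) = 0 := by funext x; exact deriv_const x (0 : ℂ)
  induction j with
  | zero =>
    rw [Function.iterate_one, D_glue contDiff_zero' (contDiff_mono 0), deriv_mono_zero, hz]
    have : glue 0 0 = 0 := by
      rw [glue, ← reg_zero]; congr 1; funext x; simp
    rw [this]
    ext t
    simp [mono]
  | succ j ih =>
    rw [Function.iterate_succ_apply, D_glue contDiff_zero' (contDiff_mono _), deriv_mono_succ, hz]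
    have : mono (j + 1) 0 - (0 : ℝ → ℂ) 0 = 0 := by simp [mono]
    rw [this, ← ih]
    congr 1
    ext t
    simp

theorem exists_D_iterate_delta_eq {k r : ℕ} (hk : k < r) :
    ∃ g : ℝ → ℂ, LocallyIntegrable g volume ∧ D^[k] delta = D^[r] (reg g) := by
  obtain ⟨j, rfl⟩ := Nat.exists_eq_add_of_lt hk
  refine ⟨_, locallyIntegrable_glue contDiff_zero'.continuous (contDiff_mono j).continuous, ?_⟩
  rw [← D_iterate_glue_mono j, ← Function.iterate_add_apply]
  rfl

theorem ord_deltaComb_le {c : ℕ →₀ ℂ} {r : ℕ} (hc : ∀ k, c k ≠ 0 → k < r) :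
    ord (deltaComb c) ≤ r := by
  refine sInf_le ⟨r, ?_, rfl⟩
  refine Finset.sum_induction _
    (fun F : Distr => ∃ g : ℝ → ℂ, LocallyIntegrable g volume ∧ F = D^[r] (reg g)) ?_ ?_ ?_
  · rintro F G ⟨g, hg, rfl⟩ ⟨h, hh, rfl⟩
    exact ⟨g + h, hg.add hh, by rw [reg_add hg hh, D_iterate_add]⟩
  · exact ⟨0, locallyIntegrable_zero, by rw [reg_zero, D_iterate_zero]⟩
  · intro k hk
    obtain ⟨g, hg, e⟩ := exists_D_iterate_delta_eq (hc k (Finsupp.mem_support_iff.1 hk))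
    exact ⟨c k • g, hg.smul _, by rw [reg_const_smul hg, D_iterate_smul, ← e]⟩

/-! ### Borel's lemma and the extension of smooth functions on half-lines -/

/-- The normalization `r⁻¹ ^ k` keeps the `k`-th derivative at 0 fixed and leaves a spare factor at
most `r⁻¹` in all lower derivatives. -/
theorem norm_iteratedDeriv_dilate_jet_le {k j : ℕ} {c : ℂ} {r E : ℝ} (hr : 1 ≤ r)
    (hE : ∀ j ≤ k, ∀ x, ‖iteratedDeriv j (jet k) x‖ ≤ E) (hj : j < k) (x : ℝ) :
    ‖c * (r : ℂ)⁻¹ ^ k * ((r : ℂ) ^ j * iteratedDeriv j (jet k) (r * x))‖ ≤ ‖c‖ * E * r⁻¹ := by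
  have hr0 : 0 < r := by linarith
  have hE0 : 0 ≤ E := (norm_nonneg _).trans (hE 0 (Nat.zero_le _) 0)
  have e : r⁻¹ ^ k * r ^ j ≤ r⁻¹ := by
    obtain ⟨i, rfl⟩ := Nat.exists_eq_add_of_lt hj
    have : r⁻¹ ^ (j + i + 1) * r ^ j = r⁻¹ ^ (i + 1) := by
      rw [show j + i + 1 = (i + 1) + j by ring, pow_add, mul_assoc, ← mul_pow,
        inv_mul_cancel₀ hr0.ne', one_pow, mul_one]
    rw [this]
    exact pow_le_of_le_one (by positivity) (inv_le_one_of_one_le₀ hr) (by omega)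
  simp only [norm_mul, norm_pow, norm_inv, Complex.norm_real, Real.norm_of_nonneg hr0.le]
  calc ‖c‖ * r⁻¹ ^ k * (r ^ j * ‖iteratedDeriv j (jet k) (r * x)‖)
      ≤ ‖c‖ * r⁻¹ ^ k * (r ^ j * E) := by gcongr; exact hE j hj.le _
    _ = ‖c‖ * E * (r⁻¹ ^ k * r ^ j) := by ring
    _ ≤ ‖c‖ * E * r⁻¹ := by gcongr

/-- Borel's lemma: every sequence is the sequence of derivatives at the origin of a smooth
function. -/
theorem exists_contDiff_iteratedDeriv_eq (c : ℕ → ℂ) :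
    ∃ h : ℝ → ℂ, ContDiff ℝ ∞ h ∧ ∀ j, iteratedDeriv j h 0 = c j := by
  choose E hE0 hE using fun k => exists_bound_iteratedDeriv (jet k) k
  -- This scale makes every derivative of order below `k` of the `k`-th term at most `(1 / 2) ^ k`.
  set r : ℕ → ℝ := fun k => 1 + ‖c k‖ * E k * 2 ^ k with hr
  have hr1 : ∀ k, 1 ≤ r k := fun k => by
    have := hE0 k
    simp only [hr]
    have : 0 ≤ ‖c k‖ * E k * 2 ^ k := by positivity
    linarith
  have hr0 : ∀ k, r k ≠ 0 := fun k => by linarith [hr1 k]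
  let T : ℕ → TestFn := fun k => (c k * (r k : ℂ)⁻¹ ^ k) • dilate (r k) (hr0 k) (jet k)
  have hT : ∀ k j x, iteratedDeriv j (T k) x =
      c k * (r k : ℂ)⁻¹ ^ k * ((r k : ℂ) ^ j * iteratedDeriv j (jet k) (r k * x)) := by
    intro k j x
    have e : ⇑(T k) = fun x => (c k * (r k : ℂ)⁻¹ ^ k) * jet k (r k * x) := rfl
    rw [e, iteratedDeriv_const_mul _
      ((contDiff_comp_mul (jet k) (r k)).of_le (by exact_mod_cast le_top)).contDiffAt,
      iteratedDeriv_comp_mul]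
  have hsmall : ∀ k j, j < k → ∀ x, ‖iteratedDeriv j (T k) x‖ ≤ (1 / 2) ^ k := by
    intro k j hj x
    rw [hT]
    refine (norm_iteratedDeriv_dilate_jet_le (hr1 k) (hE k) hj x).trans ?_
    rw [← div_eq_mul_inv, div_le_iff₀ (by linarith [hr1 k])]
    have h2 : ((1 : ℝ) / 2) ^ k * 2 ^ k = 1 := by rw [← mul_pow]; norm_num
    have h3 : (0 : ℝ) ≤ (1 / 2) ^ k := by positivity
    have h4 : ((1 : ℝ) / 2) ^ k * r k = (1 / 2) ^ k + ‖c k‖ * E k * ((1 / 2) ^ k * 2 ^ k) := by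
      simp only [hr]; ring
    rw [h4, h2]
    linarith
  choose B _ hB using fun k j => exists_bound_iteratedDeriv (T k) j
  -- For each `j` only the finitely many terms `k ≤ j` escape the geometric bound; for these any
  -- bound will do.
  let v : ℕ → ℕ → ℝ := fun j k => if j < k then (1 / 2) ^ k else B k j
  have hv : ∀ j : ℕ, (j : ℕ∞) ≤ ⊤ → Summable (v j) := by
    intro j _
    rw [← summable_nat_add_iff (j + 1)]
    have : Summable fun k => ((1 : ℝ) / 2) ^ (k + (j + 1)) :=
      (summable_nat_add_iff (j + 1)).2 summable_geometric_two
    refine this.congr fun k => ?_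
    simp only [v]
    rw [if_pos (by omega)]
  have hle : ∀ (j k : ℕ) (x : ℝ), (j : ℕ∞) ≤ ⊤ → ‖iteratedFDeriv ℝ j (T k) x‖ ≤ v j k := by
    intro j k x _
    rw [norm_iteratedFDeriv_eq_norm_iteratedDeriv]
    simp only [v]
    split_ifs with h
    · exact hsmall k j h x
    · exact hB k j j le_rfl x
  refine ⟨fun x => ∑' k, T k x, contDiff_tsum (fun k => (T k).smooth) hv hle, fun j => ?_⟩
  rw [iteratedDeriv_eq_iteratedFDeriv,
    iteratedFDeriv_tsum_apply (fun k => (T k).smooth) hv hle le_top, tsum_eq_single j,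
    ← iteratedDeriv_eq_iteratedFDeriv, hT, mul_zero, iteratedDeriv_jet, if_pos rfl, mul_one,
    mul_assoc, ← mul_pow, inv_mul_cancel₀, one_pow, mul_one]
  · exact_mod_cast hr0 j
  · intro k hk
    rw [← norm_eq_zero, norm_iteratedFDeriv_eq_norm_iteratedDeriv, hT, mul_zero, iteratedDeriv_jet,
      if_neg hk.symm]
    simp

/-- On the left of 0, continue by a Borel function with the same one-sided derivatives at 0. The
glued derivatives `G k` then agree at 0 from both sides, so `G (k + 1)` is the derivative of `G k`
everywhere. -/
theorem exists_contDiff_eqOn_Ici {φ : ℝ → ℂ} (hφ : ContDiffOn ℝ ∞ φ (Set.Ici 0)) :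
    ∃ g : ℝ → ℂ, ContDiff ℝ ∞ g ∧ Set.EqOn g φ (Set.Ici 0) := by
  obtain ⟨h, hh, hh0⟩ :=
    exists_contDiff_iteratedDeriv_eq fun j => iteratedDerivWithin j φ (Set.Ici 0) 0
  let G : ℕ → ℝ → ℂ := fun k x =>
    if 0 ≤ x then iteratedDerivWithin k φ (Set.Ici 0) x else iteratedDeriv k h x
  have hGp : ∀ k, Set.EqOn (G k) (iteratedDerivWithin k φ (Set.Ici 0)) (Set.Ici 0) :=
    fun k x hx => if_pos hx
  have hGm : ∀ k, Set.EqOn (G k) (iteratedDeriv k h) (Set.Iic 0) := by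
    intro k x hx
    rcases (Set.mem_Iic.1 hx).lt_or_eq with h1 | rfl
    · exact if_neg (not_le.2 h1)
    · rw [hGp k Set.self_mem_Ici, hh0]
  have hp : ∀ k, ∀ x ∈ Set.Ici (0 : ℝ), HasDerivWithinAt (G k) (G (k + 1) x) (Set.Ici 0) x := by
    intro k x hx
    have h1 := (hφ.differentiableOn_iteratedDerivWithin (m := k) (by exact_mod_cast ENat.natCast_lt_top k)
      (uniqueDiffOn_Ici 0) x hx).hasDerivWithinAt
    rw [← iteratedDerivWithin_succ] at h1
    rw [hGp _ hx]
    exact h1.congr (hGp k) (hGp k hx)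
  have hm : ∀ k, ∀ x ∈ Set.Iic (0 : ℝ), HasDerivWithinAt (G k) (G (k + 1) x) (Set.Iic 0) x := by
    intro k x hx
    have h1 := ((contDiff_iteratedDeriv hh k).differentiable (by simp) x).hasDerivAt
    rw [← iteratedDeriv_succ] at h1
    rw [hGm _ hx]
    exact h1.hasDerivWithinAt.congr (hGm k) (hGm k hx)
  have hd : ∀ k x, HasDerivAt (G k) (G (k + 1) x) x := by
    intro k x
    rcases lt_trichotomy x 0 with h1 | rfl | h1
    · exact (hm k x h1.le).hasDerivAt (Iic_mem_nhds h1)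
    · have := (hp k 0 Set.self_mem_Ici).union (hm k 0 Set.self_mem_Iic)
      rwa [Set.union_comm, Set.Iic_union_Ici, hasDerivWithinAt_univ] at this
    · exact (hp k x h1.le).hasDerivAt (Ici_mem_nhds h1)
  have hit : ∀ k, iteratedDeriv k (G 0) = G k := by
    intro k
    induction k with
    | zero => simp
    | succ k ih => rw [iteratedDeriv_succ, ih]; exact funext fun x => (hd k x).deriv
  refine ⟨G 0, contDiff_of_differentiable_iteratedDeriv fun m _ => ?_, fun x hx => ?_⟩
  · rw [hit]; exact fun x => (hd m x).differentiableAt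
  · rw [hGp 0 hx, iteratedDerivWithin_zero]

theorem exists_contDiff_eqOn_Iic {φ : ℝ → ℂ} (hφ : ContDiffOn ℝ ∞ φ (Set.Iic 0)) :
    ∃ g : ℝ → ℂ, ContDiff ℝ ∞ g ∧ Set.EqOn g φ (Set.Iic 0) := by
  obtain ⟨g, hg, he⟩ := exists_contDiff_eqOn_Ici (φ := fun x => φ (-x))
    (hφ.comp contDiff_neg.contDiffOn fun x hx => by simpa using hx)
  refine ⟨fun x => g (-x), hg.comp contDiff_neg, fun x hx => ?_⟩
  have := he (x := -x) (by simpa using hx)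
  simpa using this

theorem iteratedDerivWithin_eq_of_eqOn {φ g : ℝ → ℂ} {S : Set ℝ} (hS : UniqueDiffOn ℝ S)
    (hg : ContDiff ℝ ∞ g) (he : Set.EqOn g φ S) {x : ℝ} (hx : x ∈ S) (i : ℕ) :
    iteratedDerivWithin i φ S x = iteratedDeriv i g x := by
  rw [← iteratedDerivWithin_congr he hx]
  exact iteratedDerivWithin_eq_iteratedDeriv hS
    (hg.of_le (by exact_mod_cast le_top)).contDiffAt hx

/-! ### Solutions away from the origin -/

/-- Removing finitely many points from a nonempty open set leaves a nonempty open set. This provides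
the point at which initial data are taken. -/
theorem exists_isSmoothOn_of_mem_spaceA {ψ : Distr} (hψ : ψ ∈ spaceA) {Ω : Set ℝ} (hΩ : IsOpen Ω)
    (hne : Ω.Nonempty) : ∃ V ⊆ Ω, IsOpen V ∧ V.Nonempty ∧ ∃ g : ℝ → ℂ, IsSmoothOn ψ g V := by
  obtain ⟨k, f, ⟨I, hI, hf, -⟩, rfl⟩ := hψ
  -- This avoids proving `f` locally integrable: the replacement `h` is `f` or 0, smooth off `I` in
  -- both cases.
  obtain ⟨h, hh, he, hor⟩ := exists_locallyIntegrable_reg_eq f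
  have hV : IsOpen (Ω \ I) := hΩ.sdiff hI.isClosed
  have hinf : Ω.Infinite := by
    obtain ⟨x, hx⟩ := hne
    exact infinite_of_mem_nhds x (hΩ.mem_nhds hx)
  have hc : ContDiffOn ℝ ∞ h (Ω \ I) := by
    rcases hor with rfl | rfl
    · exact hf.mono fun x hx => hx.2
    · exact contDiffOn_const
  have heq : EqFunOn (reg f) h (Ω \ I) := fun t _ => by rw [he, reg_apply hh]
  exact ⟨Ω \ I, Set.sdiff_subset, hV, (hinf.sdiff hI).nonempty, _, heq.D_iterate hV hc k⟩

theorem IsSolution.solvesOn {n : ℕ} {a b : Fin (n + 1) → Distr} {f : ℝ → ℂ} {ψ : Distr}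
    (hψ : IsSolution a b f ψ) (hf : Continuous f) {Ω : Set ℝ} (hΩ : IsOpen Ω)
    {α β : Fin (n + 1) → ℝ → ℂ} (hα : ∀ i, ContDiff ℝ ∞ (α i)) (hβ : ∀ i, ContDiff ℝ ∞ (β i))
    (ha : ∀ i, EqFunOn (a i) (α i) Ω) (hb : ∀ i, EqFunOn (b i) (β i) Ω) :
    SolvesOn (fun i x => α i x + β i x) f Ω ψ := by
  obtain ⟨-, P, Q, hP, hQ, hsum⟩ := hψ
  refine ⟨hΩ, fun i => ((hα i).add (hβ i)).contDiffOn, fun t ht => ?_⟩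
  rw [← reg_apply hf.locallyIntegrable, ← hsum, _root_.sum_apply]
  refine Finset.sum_congr rfl fun i _ => ?_
  rw [_root_.add_apply, (hP i).apply_left (hα i) hΩ (ha i) ht,
    (hQ i).apply_right (hβ i) hΩ (hb i) ht, ← map_add]
  congr 1
  exact TestFunction.ext fun x => by simp [add_mul]

/-- On a regular interval, a solution is a function that is smooth up to the boundary and satisfies
the equation in the classical sense. -/
theorem IsSolution.exists_classical {n : ℕ} {a b : Fin (n + 1) → Distr} {f : ℝ → ℂ} {ψ : Distr}
    (hψ : IsSolution a b f ψ) (hreg : SectionallyRegular a b f) (hf : Continuous f) {Ω : Set ℝ}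
    (hΩ : IsOpen Ω) (hconn : Ω.OrdConnected) (hne : Ω.Nonempty)
    {α β : Fin (n + 1) → ℝ → ℂ} (hα : ∀ i, ContDiff ℝ ∞ (α i)) (hβ : ∀ i, ContDiff ℝ ∞ (β i))
    (ha : ∀ i, EqFunOn (a i) (α i) Ω) (hb : ∀ i, EqFunOn (b i) (β i) Ω) :
    ∃ φ : ℝ → ℂ, ContDiffOn ℝ ∞ φ (closure Ω) ∧
      (∀ x ∈ closure Ω, ∑ i : Fin (n + 1),
        (α i x + β i x) * iteratedDerivWithin (i : ℕ) φ (closure Ω) x = f x) ∧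
      EqFunOn ψ φ Ω := by
  obtain ⟨V, hVΩ, hV, ⟨x₀, hx₀⟩, g, hg, hψg⟩ := exists_isSmoothOn_of_mem_spaceA hψ.1 hΩ hne
  have hsing : ∀ {F : Distr} {γ : ℝ → ℂ}, ContDiff ℝ ∞ γ → EqFunOn F γ Ω →
      Disjoint Ω (singSupp F) := fun hγ hF =>
    Set.disjoint_left.2 fun x hx h => h ⟨Ω, hΩ, hx, _, hγ.contDiffOn, hF⟩
  -- The initial data are those of `ψ` itself at `x₀`, so the uniqueness clause `h3` applies to `ψ`.
  obtain ⟨φ, h1, h2, -, h3⟩ := hreg Ω hΩ hconn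
    (fun i => ⟨hsing (hα i) (ha i), hsing (hβ i) (hb i)⟩) α β
    (fun i => ⟨(hα i).contDiffOn, ha i⟩) (fun i => ⟨(hβ i).contDiffOn, hb i⟩) x₀
    (subset_closure (hVΩ hx₀)) fun j => iteratedDerivWithin (j : ℕ) g (V ∩ closure Ω) x₀
  refine ⟨φ, h1, h2, h3 ψ hψ.1 (hψ.solvesOn hf hΩ hα hβ ha hb) ?_⟩
  exact ⟨V, hV, hx₀, g, hg.mono Set.inter_subset_left, hψg.mono Set.inter_subset_left,
    fun _ => rfl⟩

theorem EqFunOn.congr {F : Distr} {g h : ℝ → ℂ} {Ξ : Set ℝ} (hF : EqFunOn F g Ξ)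
    (hgh : Set.EqOn g h Ξ) : EqFunOn F h Ξ := by
  intro t ht
  rw [hF t ht]
  refine integral_congr_ae (Eventually.of_forall fun x => ?_)
  by_cases hx : x ∈ tsupport t
  · simp only [hgh (ht hx)]
  · simp [image_eq_zero_of_notMem_tsupport hx]

theorem contDiffOn_H : ContDiffOn ℝ ∞ H {0}ᶜ := by
  intro x hx
  rcases lt_or_gt_of_ne hx with h | h
  · refine (contDiffAt_const (c := (0 : ℂ)).congr_of_eventuallyEq ?_).contDiffWithinAt
    filter_upwards [Iio_mem_nhds h] with y hy using H_of_neg hy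
  · refine (contDiffAt_const (c := (1 : ℂ)).congr_of_eventuallyEq ?_).contDiffWithinAt
    filter_upwards [Ioi_mem_nhds h] with y hy using H_of_nonneg (le_of_lt hy)

theorem contDiffOn_Hminus : ContDiffOn ℝ ∞ Hminus {0}ᶜ := contDiffOn_const.sub contDiffOn_H

/-- Off the origin `H` is smooth, so a test function vanishing near 0 splits by `Hminus` and `H`
into one test function on each open half-line. -/
theorem apply_eq_of_eqFunOn {F G : Distr} {u v : ℝ → ℂ} (hFu : EqFunOn F u (Set.Iio 0))
    (hFv : EqFunOn F v (Set.Ioi 0)) (hGu : EqFunOn G u (Set.Iio 0))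
    (hGv : EqFunOn G v (Set.Ioi 0)) {t : TestFn} (ht : (0 : ℝ) ∉ tsupport t) : F t = G t := by
  have hne : ∀ x ∈ tsupport t, x ≠ 0 := by rintro _ hx rfl; exact ht hx
  have ht' : tsupport t ⊆ {0}ᶜ := hne
  let t1 := mulTest isOpen_compl_singleton contDiffOn_Hminus t ht'
  let t2 := mulTest isOpen_compl_singleton contDiffOn_H t ht'
  have hsplit : t = t1 + t2 := TestFunction.ext fun x => by
    simp only [t1, t2, _root_.add_apply, mulTest_apply, Hminus]; ring
  have h1 : tsupport t1 ⊆ Set.Iio 0 := by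
    have ha : tsupport t1 ⊆ Set.Iic 0 := closure_minimal (fun x hx => by
      by_contra h
      exact hx (by simp [t1, Hminus_of_nonneg (not_le.1 h).le])) isClosed_Iic
    have hb : tsupport t1 ⊆ tsupport t := tsupport_mul_subset_right
    exact fun x hx => lt_of_le_of_ne (Set.mem_Iic.1 (ha hx)) (hne x (hb hx))
  have h2 : tsupport t2 ⊆ Set.Ioi 0 := by
    have ha : tsupport t2 ⊆ Set.Ici 0 := closure_minimal (fun x hx => by
      by_contra h
      exact hx (by simp [t2, H_of_neg (not_le.1 h)])) isClosed_Ici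
    have hb : tsupport t2 ⊆ tsupport t := tsupport_mul_subset_right
    exact fun x hx => lt_of_le_of_ne (Set.mem_Ici.1 (ha hx)) (hne x (hb hx)).symm
  rw [hsplit, map_add, map_add, hFu _ h1, hFv _ h2, hGu _ h1, hGv _ h2]

/-! ### The singular part of a solution -/

theorem iteratedDeriv_smoothMul_jet {g : ℝ → ℂ} (hg : ContDiff ℝ ∞ g) {k N : ℕ} (hk : k ≤ N) :
    iteratedDeriv k (smoothMul g hg (jet N)) 0 = if k = N then g 0 else 0 := by
  rw [coe_smoothMul, iteratedDeriv_fun_mul (hg.of_le (by exact_mod_cast le_top)).contDiffAt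
    ((jet N).smooth.of_le (by exact_mod_cast le_top)).contDiffAt]
  simp only [iteratedDeriv_jet]
  rw [Finset.sum_eq_single 0]
  · simp
  · intro i hi hi0
    have := Finset.mem_range.1 hi
    rw [if_neg (by omega), mul_zero]
  · simp

/-- The jet vanishes to order `N` at 0, so degrees below `N` contribute nothing, and in degree `N`
the multiplier `g` enters only through `g 0`. -/
theorem deltaComb_smoothMul_jet {c : ℕ →₀ ℂ} {N : ℕ} (hc : ∀ k, N < k → c k = 0) {g : ℝ → ℂ}
    (hg : ContDiff ℝ ∞ g) :
    deltaComb c (smoothMul g hg (jet N)) = c N * ((-1) ^ N * g 0) := by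
  rw [deltaComb_apply, Finsupp.sum, Finset.sum_eq_single N]
  · rw [iteratedDeriv_smoothMul_jet hg le_rfl, if_pos rfl]
  · intro k hk hkN
    have hkN' : k ≤ N := by
      by_contra h
      exact Finsupp.mem_support_iff.1 hk (hc k (not_le.1 h))
    rw [iteratedDeriv_smoothMul_jet hg hkN', if_neg hkN, mul_zero, mul_zero]
  · intro h
    rw [Finsupp.notMem_support_iff.1 h, zero_mul]

theorem deltaComb_smoothMul_jet_eq_zero {c : ℕ →₀ ℂ} {N : ℕ} (hc : ∀ k, N ≤ k → c k = 0)
    {g : ℝ → ℂ} (hg : ContDiff ℝ ∞ g) : deltaComb c (smoothMul g hg (jet N)) = 0 := by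
  rw [deltaComb_smoothMul_jet (fun k hk => hc k hk.le), hc N le_rfl, zero_mul]

/-- The equation evaluated at a test function, for a solution that is piecewise smooth up to a
combination of derivatives of the Dirac measure: the function parts cancel. -/
theorem IsSolution.sum_singular_eq_zero {n : ℕ} {am ap bm bp : Fin (n + 1) → ℝ → ℂ}
    (ham : ∀ i, ContDiff ℝ ∞ (am i)) (hap : ∀ i, ContDiff ℝ ∞ (ap i))
    (hbm : ∀ i, ContDiff ℝ ∞ (bm i)) (hbp : ∀ i, ContDiff ℝ ∞ (bp i))
    {cA cB c : Fin (n + 1) → ℕ →₀ ℂ} {f : ℝ → ℂ} (hf : ContDiff ℝ ∞ f)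
    {a b : Fin (n + 1) → Distr} (ha : ∀ i, a i = glue (am i) (ap i) + deltaComb (cA i))
    (hb : ∀ i, b i = glue (bm i) (bp i) + deltaComb (cB i))
    {ψ : Distr} (hψ : IsSolution a b f ψ) {ψm ψp : ℝ → ℂ} (hm : ContDiff ℝ ∞ ψm)
    (hp : ContDiff ℝ ∞ ψp)
    (hc : ∀ i : Fin (n + 1), D^[(i : ℕ)] ψ =
      glue (iteratedDeriv i ψm) (iteratedDeriv i ψp) + deltaComb (c i))
    (hem : ∀ x ≤ 0, ∑ i : Fin (n + 1), (am i x + bm i x) * iteratedDeriv (i : ℕ) ψm x = f x)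
    (hep : ∀ x ≥ 0, ∑ i : Fin (n + 1), (ap i x + bp i x) * iteratedDeriv (i : ℕ) ψp x = f x)
    (t : TestFn) :
    ∑ i : Fin (n + 1),
      (deltaComb (c i) (smoothMul (am i) (ham i) t) + deltaComb (c i) (smoothMul (bp i) (hbp i) t) +
        (deltaComb (cA i) (smoothMul _ (contDiff_iteratedDeriv hp i) t) +
          deltaComb (cB i) (smoothMul _ (contDiff_iteratedDeriv hm i) t))) = 0 := by
  obtain ⟨-, P, Q, hP, hQ, hsum⟩ := hψ
  have hm' := fun i : Fin (n + 1) => contDiff_iteratedDeriv hm (i : ℕ)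
  have hp' := fun i : Fin (n + 1) => contDiff_iteratedDeriv hp (i : ℕ)
  have e : ∑ i : Fin (n + 1), (P i t + Q i t) = ∫ x, f x * t x := by
    rw [← reg_apply hf.continuous.locallyIntegrable, ← hsum, _root_.sum_apply]
    rfl
  -- The order of the factors decides the branches: the delta part of the `i`-th derivative of `ψ`
  -- meets `am i` in `P i` and `bp i` in `Q i`, which is why the leading number mixes the two sides.
  have eP := fun i : Fin (n + 1) => IsStarProd.apply_glue (ham i) (hap i) (hm' i) (hp' i) (cA i)
    (c i) (P := P i) (by rw [← ha i, ← hc i]; exact hP i) t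
  have eQ := fun i : Fin (n + 1) => IsStarProd.apply_glue (hm' i) (hp' i) (hbm i) (hbp i) (c i)
    (cB i) (P := Q i) (by rw [← hb i, ← hc i]; exact hQ i) t
  have hint : ∀ u v : ℝ → ℂ, Continuous u → Continuous v →
      Integrable fun x => (Hminus x * u x + H x * v x) * t x := fun u v hu hv =>
    integrable_mul_test (locallyIntegrable_glue hu hv) t
  have i1 := fun i : Fin (n + 1) => hint (fun x => am i x * iteratedDeriv (i : ℕ) ψm x)
    (fun x => ap i x * iteratedDeriv (i : ℕ) ψp x) ((ham i).continuous.mul (hm' i).continuous)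
    ((hap i).continuous.mul (hp' i).continuous)
  have i2 := fun i : Fin (n + 1) => hint (fun x => iteratedDeriv (i : ℕ) ψm x * bm i x)
    (fun x => iteratedDeriv (i : ℕ) ψp x * bp i x) ((hm' i).continuous.mul (hbm i).continuous)
    ((hp' i).continuous.mul (hbp i).continuous)
  have hI : ∑ i : Fin (n + 1), ((∫ x, (Hminus x * (am i x * iteratedDeriv (i : ℕ) ψm x) +
      H x * (ap i x * iteratedDeriv (i : ℕ) ψp x)) * t x) +
      ∫ x, (Hminus x * (iteratedDeriv (i : ℕ) ψm x * bm i x) +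
        H x * (iteratedDeriv (i : ℕ) ψp x * bp i x)) * t x) = ∫ x, f x * t x := by
    rw [Finset.sum_congr rfl fun i _ => (integral_add' (i1 i) (i2 i)).symm,
      ← integral_finsetSum _ fun i _ => (i1 i).add (i2 i)]
    congr 1
    funext x
    simp only [Pi.add_apply]
    rcases le_or_gt 0 x with h | h
    · simp only [H_of_nonneg h, Hminus_of_nonneg h, zero_mul, zero_add, one_mul]
      rw [← hep x h, Finset.sum_mul]
      exact Finset.sum_congr rfl fun i _ => by ring
    · simp only [H_of_neg h, Hminus_of_neg h, zero_mul, add_zero, one_mul]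
      rw [← hem x h.le, Finset.sum_mul]
      exact Finset.sum_congr rfl fun i _ => by ring
  rw [← hI, ← sub_eq_zero, ← Finset.sum_sub_distrib] at e
  rw [← e]
  refine Finset.sum_congr rfl fun i _ => ?_
  rw [eP, eQ]
  ring

/-- The coefficients of the singular part of a solution vanish from degree `m - n` on, where `m`
bounds the orders of the singular parts of the coefficients of the equation. -/
theorem IsSolution.singular_coeff_eq_zero {n : ℕ} {am ap bm bp : Fin (n + 1) → ℝ → ℂ}
    (ham : ∀ i, ContDiff ℝ ∞ (am i)) (hap : ∀ i, ContDiff ℝ ∞ (ap i))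
    (hbm : ∀ i, ContDiff ℝ ∞ (bm i)) (hbp : ∀ i, ContDiff ℝ ∞ (bp i))
    {cA cB : Fin (n + 1) → ℕ →₀ ℂ} {f : ℝ → ℂ} (hf : ContDiff ℝ ∞ f)
    {a b : Fin (n + 1) → Distr} (ha : ∀ i, a i = glue (am i) (ap i) + deltaComb (cA i))
    (hb : ∀ i, b i = glue (bm i) (bp i) + deltaComb (cB i))
    (hlead : am (Fin.last n) 0 + bp (Fin.last n) 0 ≠ 0)
    {m : ℕ} (hA : ∀ i k, m ≤ k → cA i k = 0) (hB : ∀ i k, m ≤ k → cB i k = 0)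
    {ψm ψp : ℝ → ℂ} (hm : ContDiff ℝ ∞ ψm) (hp : ContDiff ℝ ∞ ψp) {d : ℕ →₀ ℂ}
    (hψ : IsSolution a b f (glue ψm ψp + deltaComb d))
    (hem : ∀ x ≤ 0, ∑ i : Fin (n + 1), (am i x + bm i x) * iteratedDeriv (i : ℕ) ψm x = f x)
    (hep : ∀ x ≥ 0, ∑ i : Fin (n + 1), (ap i x + bp i x) * iteratedDeriv (i : ℕ) ψp x = f x)
    (k : ℕ) (hk : d k ≠ 0) : k + n < m := by
  choose c hc hD using fun i : Fin (n + 1) => D_iterate_glue_add_deltaComb hm hp d i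
  have hne : d.support.Nonempty := ⟨k, Finsupp.mem_support_iff.2 hk⟩
  set N := d.support.max' hne with hN
  have hNd : d N ≠ 0 := Finsupp.mem_support_iff.1 (d.support.max'_mem hne)
  have hd : ∀ j, N < j → d j = 0 := fun j hj => by
    by_contra h
    exact absurd (d.support.le_max' j (Finsupp.mem_support_iff.2 h)) (not_le.2 hj)
  have hkN : k ≤ N := d.support.le_max' k (Finsupp.mem_support_iff.2 hk)
  by_contra! hcon
  have hmN : m ≤ N + n := by omega
  have hci : ∀ (i : Fin (n + 1)) j, N + i < j → c i j = 0 := fun i j hj => by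
    obtain ⟨l, rfl⟩ := Nat.exists_eq_add_of_le' (show (i : ℕ) ≤ j by omega)
    rw [hc]
    exact hd l (by omega)
  -- This jet isolates degree `N + n`: terms with `i < n` reach only degree `N + i`, and the delta
  -- parts of the coefficients stop below `m ≤ N + n`. What remains is `d N` times the leading
  -- number, up to sign.
  have key := hψ.sum_singular_eq_zero ham hap hbm hbp hf ha hb hm hp hD hem hep (jet (N + n))
  rw [Finset.sum_eq_single (Fin.last n)] at key
  · have hcl : ∀ j, N + n < j → c (Fin.last n) j = 0 := hci (Fin.last n)
    rw [deltaComb_smoothMul_jet hcl, deltaComb_smoothMul_jet hcl,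
      deltaComb_smoothMul_jet_eq_zero fun j hj => hA _ j (hmN.trans hj),
      deltaComb_smoothMul_jet_eq_zero fun j hj => hB _ j (hmN.trans hj)] at key
    have hcN : c (Fin.last n) (N + n) = d N := hc (Fin.last n) N
    rw [hcN] at key
    have : d N * (-1) ^ (N + n) * (am (Fin.last n) 0 + bp (Fin.last n) 0) = 0 := by
      rw [← key]; ring
    exact mul_ne_zero (mul_ne_zero hNd (pow_ne_zero _ (by norm_num))) hlead this
  · intro i _ hi
    have hin : (i : ℕ) < n := Fin.val_lt_last hi
    have hz : ∀ j, N + n ≤ j → c i j = 0 := fun j hj => hci i j (by omega)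
    rw [deltaComb_smoothMul_jet_eq_zero hz, deltaComb_smoothMul_jet_eq_zero hz,
      deltaComb_smoothMul_jet_eq_zero fun j hj => hA _ j (hmN.trans hj),
      deltaComb_smoothMul_jet_eq_zero fun j hj => hB _ j (hmN.trans hj)]
    simp
  · simp

theorem dsupport_deltaComb_subset (d : ℕ →₀ ℂ) : Distribution.dsupport (deltaComb d) ⊆ {0} :=
  Set.sInter_subset_of_mem ⟨fun _ ht =>
    deltaComb_eq_zero_of_tsupport d fun h => ht h rfl, isClosed_singleton⟩

end

end SingularODE

theorem theorem3p6 (n : ℕ)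
    (am ap bm bp : Fin (n + 1) → ℝ → ℂ)
    (ham : ∀ i, ContDiff ℝ ∞ (am i)) (hap : ∀ i, ContDiff ℝ ∞ (ap i))
    (hbm : ∀ i, ContDiff ℝ ∞ (bm i)) (hbp : ∀ i, ContDiff ℝ ∞ (bp i))
    (cA cB : Fin (n + 1) → ℕ →₀ ℂ)
    (f : ℝ → ℂ) (hf : ContDiff ℝ ∞ f)
    (a b : Fin (n + 1) → Distr)
    (ha : ∀ i, a i = glue (am i) (ap i) + deltaComb (cA i))
    (hb : ∀ i, b i = glue (bm i) (bp i) + deltaComb (cB i))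
    (hlead : am (Fin.last n) 0 + bp (Fin.last n) 0 ≠ 0)
    (hreg : SectionallyRegular a b f)
    (M : ℕ∞) (hM : M = ⨆ i : Fin (n + 1), max (ord (deltaComb (cA i))) (ord (deltaComb (cB i))))
    (ψ : Distr) (hψ : IsSolution a b f ψ) :
    ∃ (ψm ψp : ℝ → ℂ) (Δ : Distr),
      ContDiff ℝ ∞ ψm ∧ ContDiff ℝ ∞ ψp ∧
      ψ = glue ψm ψp + Δ ∧
      (∀ x ≤ 0, ∑ i : Fin (n + 1), (am i x + bm i x) * iteratedDeriv (i : ℕ) ψm x = f x) ∧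
      (∀ x ≥ 0, ∑ i : Fin (n + 1), (ap i x + bp i x) * iteratedDeriv (i : ℕ) ψp x = f x) ∧
      (M ≤ n → Δ = 0) ∧
      ((n : ℕ∞) < M → Distribution.dsupport Δ ⊆ {0} ∧ ord Δ ≤ M - n) := by
  have hplus : ∀ {u v : ℝ → ℂ} {c : ℕ →₀ ℂ} {F : Distr}, ContDiff ℝ ∞ u → ContDiff ℝ ∞ v →
      F = glue u v + deltaComb c → EqFunOn F v (Set.Ioi 0) := by
    rintro u v c F hu hv rfl
    exact add_deltaComb_eqFunOn (glue_eqFunOn_Ioi hu.continuous hv.continuous) (by simp) c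
  have hminus : ∀ {u v : ℝ → ℂ} {c : ℕ →₀ ℂ} {F : Distr}, ContDiff ℝ ∞ u → ContDiff ℝ ∞ v →
      F = glue u v + deltaComb c → EqFunOn F u (Set.Iio 0) := by
    rintro u v c F hu hv rfl
    exact add_deltaComb_eqFunOn (glue_eqFunOn_Iio hu.continuous hv.continuous) (by simp) c
  obtain ⟨φp, hp1, hp2, hp3⟩ := hψ.exists_classical hreg hf.continuous isOpen_Ioi
    Set.ordConnected_Ioi (Set.nonempty_Ioi (a := (0 : ℝ))) hap hbp
    (fun i => hplus (ham i) (hap i) (ha i)) (fun i => hplus (hbm i) (hbp i) (hb i))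
  obtain ⟨φm, hm1, hm2, hm3⟩ := hψ.exists_classical hreg hf.continuous isOpen_Iio
    Set.ordConnected_Iio (Set.nonempty_Iio (a := (0 : ℝ))) ham hbm
    (fun i => hminus (ham i) (hap i) (ha i)) (fun i => hminus (hbm i) (hbp i) (hb i))
  rw [closure_Ioi] at hp1 hp2
  rw [closure_Iio] at hm1 hm2
  obtain ⟨ψp, hp, hpe⟩ := exists_contDiff_eqOn_Ici hp1
  obtain ⟨ψm, hm, hme⟩ := exists_contDiff_eqOn_Iic hm1
  have hem : ∀ x ≤ 0, ∑ i : Fin (n + 1), (am i x + bm i x) * iteratedDeriv (i : ℕ) ψm x = f x := by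
    intro x hx
    rw [← hm2 x hx]
    simp_rw [iteratedDerivWithin_eq_of_eqOn (uniqueDiffOn_Iic 0) hm hme (Set.mem_Iic.2 hx)]
  have hep : ∀ x ≥ 0, ∑ i : Fin (n + 1), (ap i x + bp i x) * iteratedDeriv (i : ℕ) ψp x = f x := by
    intro x hx
    rw [← hp2 x hx]
    simp_rw [iteratedDerivWithin_eq_of_eqOn (uniqueDiffOn_Ici 0) hp hpe (Set.mem_Ici.2 hx)]
  have hψp : EqFunOn ψ ψp (Set.Ioi 0) :=
    hp3.congr fun x hx => (hpe (Set.mem_Ici.2 (le_of_lt hx))).symm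
  have hψm : EqFunOn ψ ψm (Set.Iio 0) :=
    hm3.congr fun x hx => (hme (Set.mem_Iic.2 (le_of_lt hx))).symm
  obtain ⟨d, hd⟩ := exists_eq_deltaComb (F := ψ - glue ψm ψp) fun t ht => by
    rw [_root_.sub_apply, sub_eq_zero]
    exact apply_eq_of_eqFunOn hψm hψp (glue_eqFunOn_Iio hm.continuous hp.continuous)
      (glue_eqFunOn_Ioi hm.continuous hp.continuous) ht
  have hψd : ψ = glue ψm ψp + deltaComb d := by rw [← hd]; abel
  -- Taking `m = n` leaves no degree at all, hence no remainder; taking `m = M` gives the order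
  -- bound.
  have hcoeff : ∀ m : ℕ, M ≤ m → ∀ k, d k ≠ 0 → k + n < m := by
    intro m hMm
    have hle : ∀ i, max (ord (deltaComb (cA i))) (ord (deltaComb (cB i))) ≤ m := fun i =>
      (le_iSup (fun i => max (ord (deltaComb (cA i))) (ord (deltaComb (cB i)))) i).trans
        (hM ▸ hMm)
    exact IsSolution.singular_coeff_eq_zero ham hap hbm hbp hf ha hb hlead
      (fun i k => coeff_eq_zero_of_ord_le ((le_max_left _ _).trans (hle i)))
      (fun i k => coeff_eq_zero_of_ord_le ((le_max_right _ _).trans (hle i)))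
      hm hp (hψd ▸ hψ) hem hep
  refine ⟨ψm, ψp, deltaComb d, hm, hp, hψd, hem, hep, fun hMn => ?_,
    fun hnM => ⟨dsupport_deltaComb_subset d, ?_⟩⟩
  · have : d = 0 := by
      ext k
      by_contra h
      have := hcoeff n hMn k h
      omega
    rw [this, deltaComb_zero]
  -- In the infinite case the bound is `⊤`, so nothing has to be shown.
  · induction M using ENat.recTopCoe with
    | top => simp
    | coe m =>
      rw [← ENat.natCast_sub]
      exact ord_deltaComb_le fun k hk => by
        have := hcoeff m le_rfl k hk
        omega
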